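/- Let $\mathfrak t$ be a finite-dimensional complex vector space and let $W \subset GL(\mathfrak t)$ be a finite subgroup generated by complex reflections, i.e. by automorphisms of finite order whose fixed locus is a hyperplane. Let $\mathcal A$ be the set of the fixed hyperplanes of all reflections in $W$, and let $L(\mathcal A)$ be the set of all intersections of elements of $\mathcal A$ (the empty intersection being $\mathfrak t$), on which $W$ acts. For $X \in L(\mathcal A)$ let $W_X \subset W$ be the subgroup of elements that fix every point of $X$. Regard $\mathfrak t$ as the scheme $\operatorname{Spec}\operatorname{Sym}\mathfrak t^\vee$, and put $\mathfrak t/W = \operatorname{Spec}\,(\operatorname{Sym}\mathfrak t^\vee)^W$; all schemes and morphisms are over $\mathbb C$. A *cameral cover* of a scheme $S$ is an $S$-scheme $C$ with a left action of $W$ over $S$ for which there are a surjective étale morphism $U \to S$, a morphism $U \to \mathfrak t/W$ and a $W$-equivariant isomorphism $U \times_{\mathfrak t/W} \mathfrak t \cong U \times_S C$ over $U$. A *pointed cameral cover* is a cameral cover together with a section $\sigma : S \to C$. Isomorphisms of cameral covers are $W$-equivariant isomorphisms over $S$; isomorphisms of pointed cameral covers are also required to carry one section to the other. For a subgroup $H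 \subset W$ let $Co(H,\mathfrak t) = \operatorname{Spec}\,(\operatorname{Sym}\mathfrak t^\vee / I_H)$, where $I_H$ is the ideal generated by the $H$-invariant polynomials that vanish at the origin, and let $\mathrm{ind}_H^W D = W \times_H D$ denote the balanced product, the quotient of $W \times D$ by the action $h\cdot(w,d) = (wh^{-1},hd)$ of $H$. Let $\sigma_X$ be the point of $\mathrm{ind}_{W_X}^W Co(W_X,\mathfrak t)$ given by $1 \in W$ and the origin. Then: 1. For each $X \in L(\mathcal A)$, $\mathrm{ind}_{W_X}^W Co(W_X,\mathfrak t)$ is a cameral cover of $\operatorname{Spec}\mathbb C$, and $X \mapsto (\mathrm{ind}_{W_X}^W Co(W_X,\mathfrak t), \sigma_X)$ induces a bijection from $L(\mathcal A)$ to the set of isomorphism classes of pointed cameral covers of $\operatorname{Spec}\mathbb C$. 2. $X \mapsto \mathrm{ind}_{W_X}^W Co(W_X,\mathfrak t)$ induces a bijection from the set of $W$-orbits in $L(\mathcal A)$ to the set of isomorphism classes of cameral covers of $\operatorname{Spec}\mathbb C$. In particular each cameral cover of $\operatorname{Spec}\mathbb C$ is isomorphic to $\mathrm{ind}_{W_X}^W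 Co(W_X,\mathfrak t)$ for some $X \in L(\mathcal A)$, and each pointed one to $(\mathrm{ind}_{W_X}^W Co(W_X,\mathfrak t), \sigma_X)$. -/

import Mathlib

open CategoryTheory CategoryTheory.Limits AlgebraicGeometry

noncomputable section

namespace Cameral

/-! ### Reflection arrangements -/

section Arrangement

variable {V : Type} [AddCommGroup V] [Module ℂ V]

/-- The fixed locus of a linear automorphism. -/
def fixedSpace (r : V ≃ₗ[ℂ] V) : Submodule ℂ V :=
  LinearMap.eqLocus (r : V →ₗ[ℂ] V) LinearMap.id

/-- A complex reflection: an automorphism of finite order whose fixed locus is a hyperplane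
(a maximal proper subspace). -/
def IsReflection (r : V ≃ₗ[ℂ] V) : Prop :=
  IsOfFinOrder r ∧ IsCoatom (fixedSpace r)

/-- A complex reflection group: a finite subgroup of `GL(V)` generated by complex reflections. -/
structure IsReflectionGroup (W : Subgroup (V ≃ₗ[ℂ] V)) : Prop where
  finite : Finite W
  closure_eq : Subgroup.closure {r | r ∈ W ∧ IsReflection r} = W

/-- The arrangement of mirrors: the fixed loci of all reflections in `W`. -/
def mirrors (W : Subgroup (V ≃ₗ[ℂ] V)) : Set (Submodule ℂ V) :=
  {a | ∃ r ∈ W, IsReflection r ∧ fixedSpace r = a}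

/-- The intersection poset `L(𝒜)` of the mirror arrangement: all intersections of mirrors,
the empty intersection being `V` itself. -/
def intersections (W : Subgroup (V ≃ₗ[ℂ] V)) : Set (Submodule ℂ V) :=
  {X | ∃ B ⊆ mirrors W, X = sInf B}

theorem map_fixedSpace (g r : V ≃ₗ[ℂ] V) :
    (fixedSpace r).map (g : V →ₗ[ℂ] V) = fixedSpace (g * r * g⁻¹) := by
  ext x
  simp only [fixedSpace, Submodule.mem_map, LinearMap.mem_eqLocus, LinearMap.id_apply,
    LinearEquiv.coe_coe, LinearEquiv.mul_apply]
  constructor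
  · rintro ⟨y, hy, rfl⟩
    have h : g⁻¹ (g y) = y := g.symm_apply_apply y
    rw [h, hy]
  · intro hx
    refine ⟨g⁻¹ x, ?_, g.apply_symm_apply x⟩
    apply g.injective
    rw [hx]
    exact (g.apply_symm_apply x).symm

theorem map_mem_mirrors {W : Subgroup (V ≃ₗ[ℂ] V)} {g : V ≃ₗ[ℂ] V} (hg : g ∈ W)
    {a : Submodule ℂ V} (ha : a ∈ mirrors W) : a.map (g : V →ₗ[ℂ] V) ∈ mirrors W := by
  obtain ⟨r, hr, ⟨hfin, hco⟩, rfl⟩ := ha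
  refine ⟨g * r * g⁻¹, W.mul_mem (W.mul_mem hg hr) (W.inv_mem hg), ⟨?_, ?_⟩,
    (map_fixedSpace g r).symm⟩
  · have h := (MulAut.conj g).toMonoidHom.isOfFinOrder hfin
    simpa using h
  · rw [← map_fixedSpace]
    exact ((Submodule.orderIsoMapComap g).isCoatom_iff _).2 hco

theorem map_mem_intersections {W : Subgroup (V ≃ₗ[ℂ] V)} {g : V ≃ₗ[ℂ] V} (hg : g ∈ W)
    {X : Submodule ℂ V} (hX : X ∈ intersections W) :
    X.map (g : V →ₗ[ℂ] V) ∈ intersections W := by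
  obtain ⟨B, hB, rfl⟩ := hX
  refine ⟨(fun a : Submodule ℂ V => a.map (g : V →ₗ[ℂ] V)) '' B, ?_, ?_⟩
  · rintro _ ⟨a, ha, rfl⟩
    exact map_mem_mirrors hg (hB ha)
  · have h := (Submodule.orderIsoMapComap g).map_sInf B
    rw [sInf_image]
    exact h

/-- `W` acts on `L(𝒜)` by `w • X = w(X)`. -/
instance intersectionsMulAction (W : Subgroup (V ≃ₗ[ℂ] V)) : MulAction W (intersections W) where
  smul w X := ⟨X.1.map ((w : V ≃ₗ[ℂ] V) : V →ₗ[ℂ] V), map_mem_intersections w.2 X.2⟩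
  one_smul X := Subtype.ext (Submodule.map_id X.1)
  mul_smul w v X := Subtype.ext
    (Submodule.map_comp ((v : V ≃ₗ[ℂ] V) : V →ₗ[ℂ] V) ((w : V ≃ₗ[ℂ] V) : V →ₗ[ℂ] V) X.1)

/-- The subgroup `W_X` of elements of `W` that fix every point of `X`. -/
def pointwiseStabilizer (W : Subgroup (V ≃ₗ[ℂ] V)) (X : Submodule ℂ V) : Subgroup W :=
  fixingSubgroup W (X : Set V)

end Arrangement

/-! ### The coordinate ring of `V` -/

section Coordinates

variable (V : Type) [AddCommGroup V] [Module ℂ V]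

/-- The ring `Sym(V^∨)` of polynomial functions on `V`. -/
abbrev Coord : Type := SymmetricAlgebra ℂ (Module.Dual ℂ V)

variable {V}

/-- The action of `g` on polynomial functions, `ξ ↦ ξ ∘ g⁻¹` on linear forms. -/
def coordHom (g : V ≃ₗ[ℂ] V) : Coord V →ₐ[ℂ] Coord V :=
  SymmetricAlgebra.lift
    (SymmetricAlgebra.ι ℂ (Module.Dual ℂ V) ∘ₗ ((g⁻¹ : V ≃ₗ[ℂ] V) : V →ₗ[ℂ] V).dualMap)

theorem coordHom_ι (g : V ≃ₗ[ℂ] V) (ξ : Module.Dual ℂ V) :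
    coordHom g (SymmetricAlgebra.ι ℂ (Module.Dual ℂ V) ξ) =
      SymmetricAlgebra.ι ℂ (Module.Dual ℂ V) (((g⁻¹ : V ≃ₗ[ℂ] V) : V →ₗ[ℂ] V).dualMap ξ) :=
  SymmetricAlgebra.lift_ι_apply _ ξ

theorem coordHom_one : coordHom (1 : V ≃ₗ[ℂ] V) = AlgHom.id ℂ (Coord V) :=
  SymmetricAlgebra.algHom_ext (LinearMap.ext fun ξ => coordHom_ι 1 ξ)

theorem coordHom_mul (g h : V ≃ₗ[ℂ] V) : coordHom (g * h) = (coordHom g).comp (coordHom h) := by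
  refine SymmetricAlgebra.algHom_ext (LinearMap.ext fun ξ => ?_)
  refine (coordHom_ι (g * h) ξ).trans (Eq.symm ?_)
  refine (congrArg (coordHom g) (coordHom_ι h ξ)).trans ?_
  refine (coordHom_ι g _).trans ?_
  rw [mul_inv_rev]
  rfl

instance coordMulSemiringAction : MulSemiringAction (V ≃ₗ[ℂ] V) (Coord V) where
  smul g a := coordHom g a
  one_smul a := congrArg (fun f : Coord V →ₐ[ℂ] Coord V => f a) coordHom_one
  mul_smul g h a := congrArg (fun f : Coord V →ₐ[ℂ] Coord V => f a) (coordHom_mul g h)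
  smul_zero g := map_zero (coordHom g)
  smul_add g := map_add (coordHom g)
  smul_one g := map_one (coordHom g)
  smul_mul g := map_mul (coordHom g)

theorem smul_coord_def (g : V ≃ₗ[ℂ] V) (a : Coord V) : g • a = coordHom g a := rfl

instance coordSMulCommClass : SMulCommClass (V ≃ₗ[ℂ] V) ℂ (Coord V) where
  smul_comm g c a := map_smul (coordHom g) c a

variable (V) in
/-- Evaluation of polynomial functions at the origin. -/
def evalZero : Coord V →ₐ[ℂ] ℂ := SymmetricAlgebra.algebraMapInv

end Coordinates

/-! ### Group actions on affine schemes -/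

section SpecAction

variable {B : Type} [CommRing B]

/-- The `B`-scheme `Spec A` of a `B`-algebra `A`. -/
def specOver (B A : Type) [CommRing B] [CommRing A] [Algebra B A] : Over (Spec (.of B)) :=
  Over.mk (Spec.map (CommRingCat.ofHom (algebraMap B A)))

variable {A A' : Type} [CommRing A] [Algebra B A] [CommRing A'] [Algebra B A']

theorem specMap_comp_algebraMap (f : A →ₐ[B] A') :
    Spec.map (CommRingCat.ofHom (f : A →+* A')) ≫ Spec.map (CommRingCat.ofHom (algebraMap B A)) =
      Spec.map (CommRingCat.ofHom (algebraMap B A')) := by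
  rw [← Spec.map_comp, ← CommRingCat.ofHom_comp, f.comp_algebraMap]

/-- The morphism of `B`-schemes `Spec A' ⟶ Spec A` given by a homomorphism of `B`-algebras
`A → A'`. -/
def specMap (f : A →ₐ[B] A') : specOver B A' ⟶ specOver B A :=
  Over.homMk (Spec.map (CommRingCat.ofHom (f : A →+* A'))) (specMap_comp_algebraMap f)

variable {G : Type} [Group G]

/-- If `G` acts on a `B`-algebra `A`, then `G` acts on the left on the `B`-scheme `Spec A`,
with `g` acting through the ring automorphism `g⁻¹`. For a category `𝒞`, an object of
`Action 𝒞 G` is an object of `𝒞` with a left action of `G`, so an object of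
`Action (Over S) G` is an `S`-scheme with a left action of `G` over `S`. -/
def specAction (α : G →* (A ≃ₐ[B] A)) : Action (Over (Spec (.of B))) G where
  V := specOver B A
  ρ :=
    { toFun g := specMap (α g⁻¹ : A →ₐ[B] A)
      map_one' := by
        apply Over.OverMorphism.ext
        rw [inv_one, map_one]
        exact Spec.map_id _
      map_mul' g h := by
        apply Over.OverMorphism.ext
        rw [mul_inv_rev, map_mul, End.mul_def, Over.comp_left]
        exact Spec.map_comp (CommRingCat.ofHom ((α g⁻¹ : A →ₐ[B] A) : A →+* A))
          (CommRingCat.ofHom ((α h⁻¹ : A →ₐ[B] A) : A →+* A)) }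

/-- The section of `Spec A → Spec B` given by a homomorphism of `B`-algebras `A → B`. -/
def specSection (ε : A →ₐ[B] B) : Over.mk (𝟙 (Spec (.of B))) ⟶ specOver B A :=
  Over.homMk (Spec.map (CommRingCat.ofHom (ε : A →+* B)))
    ((specMap_comp_algebraMap ε).trans (Spec.map_id _))

end SpecAction

/-! ### Cameral covers -/

section CameralCover

variable {V : Type} [AddCommGroup V] [Module ℂ V] (W : Subgroup (V ≃ₗ[ℂ] V))

/-- The algebra of `W`-invariant polynomial functions on `V`. -/
abbrev Invariants : Subalgebra ℂ (Coord V) := FixedPoints.subalgebra ℂ (Coord V) W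

/-- The quotient scheme `V/W`. -/
def quotientScheme : Scheme.{0} := Spec (.of (Invariants W))

/-- The structure morphism `V/W ⟶ Spec ℂ`. -/
def quotientToSpec : quotientScheme W ⟶ Spec (.of ℂ) :=
  Spec.map (CommRingCat.ofHom (algebraMap ℂ (Invariants W)))

/-- The scheme `V` over `V/W`, with its action of `W`. -/
def tautologicalCover : Action (Over (quotientScheme W)) W :=
  specAction (MulSemiringAction.toAlgAut W (Invariants W) (Coord V))

/-- A `W`-scheme `C` over the complex scheme `s : S ⟶ Spec ℂ` is a `(W, V)`-cameral cover if there
are a surjective étale morphism `u : U ⟶ S`, a morphism `φ : U ⟶ V/W` of complex schemes and a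
`W`-equivariant isomorphism `U ×_{V/W} V ≅ U ×_S C` over `U`. -/
def IsCameralCover {S : Scheme.{0}} (s : S ⟶ Spec (.of ℂ)) : ObjectProperty (Action (Over S) W) :=
  fun C => ∃ (U : Scheme.{0}) (u : U ⟶ S) (φ : U ⟶ quotientScheme W),
    Etale u ∧ Surjective u ∧ φ ≫ quotientToSpec W = u ≫ s ∧
    Nonempty (((Over.pullback φ).mapAction W).obj (tautologicalCover W) ≅
      ((Over.pullback u).mapAction W).obj C)

/-- Cameral covers of `S`; morphisms are the `W`-equivariant morphisms over `S`. -/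
abbrev CameralCover {S : Scheme.{0}} (s : S ⟶ Spec (.of ℂ)) := (IsCameralCover W s).FullSubcategory

/-- Isomorphism classes of cameral covers of `S`. -/
abbrev CameralCoverClass {S : Scheme.{0}} (s : S ⟶ Spec (.of ℂ)) :=
  Quotient (isIsomorphicSetoid (CameralCover W s))

/-- A cameral cover of `S` together with a section over `S`. -/
structure PointedCameralCover {S : Scheme.{0}} (s : S ⟶ Spec (.of ℂ)) where
  cover : Action (Over S) W
  isCameralCover : IsCameralCover W s cover
  pt : Over.mk (𝟙 S) ⟶ cover.V

/-- Two pointed cameral covers are isomorphic if there is a `W`-equivariant isomorphism over `S`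
that carries one section to the other. -/
instance pointedSetoid {S : Scheme.{0}} (s : S ⟶ Spec (.of ℂ)) :
    Setoid (PointedCameralCover W s) where
  r C D := ∃ e : C.cover ≅ D.cover, C.pt ≫ e.hom.hom = D.pt
  iseqv :=
    { refl := fun C => ⟨Iso.refl _, Category.comp_id _⟩
      symm := by
        rintro C D ⟨e, he⟩
        refine ⟨e.symm, ?_⟩
        rw [← he, Category.assoc, Iso.symm_hom, Action.hom_inv_hom, Category.comp_id]
      trans := by
        rintro C D E ⟨e, he⟩ ⟨f, hf⟩
        refine ⟨e.trans f, ?_⟩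
        rw [Iso.trans_hom, Action.comp_hom, ← Category.assoc, he, hf] }

/-- Isomorphism classes of pointed cameral covers of `S`. -/
abbrev PointedCameralCoverClass {S : Scheme.{0}} (s : S ⟶ Spec (.of ℂ)) :=
  Quotient (pointedSetoid W s)

end CameralCover

/-! ### The fibre over the origin -/

section Coinvariants

variable {V : Type} [AddCommGroup V] [Module ℂ V] {W : Subgroup (V ≃ₗ[ℂ] V)} (H : Subgroup W)

/-- The ideal generated by the `H`-invariant polynomial functions that vanish at the origin. -/
def coinvariantIdeal : Ideal (Coord V) :=
  Ideal.span {a | (∀ h : H, h • a = a) ∧ evalZero V a = 0}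

/-- The coinvariant algebra of `(H, V)`, that is, the coordinate ring of the fibre `Co(H, V)` of
`V → V/H` over the origin. -/
abbrev Coinvariants : Type := Coord V ⧸ coinvariantIdeal H

theorem map_coinvariantIdeal (h : H) :
    coinvariantIdeal H =
      (coinvariantIdeal H).map (MulSemiringAction.toAlgAut H ℂ (Coord V) h) := by
  rw [coinvariantIdeal, Ideal.map_span]
  congr 1
  ext a
  simp only [Set.mem_image, Set.mem_ofPred_eq]
  constructor
  · intro ha
    exact ⟨a, ha, ha.1 h⟩
  · rintro ⟨b, hb, rfl⟩
    have e : (MulSemiringAction.toAlgAut H ℂ (Coord V) h) b = b := hb.1 h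
    rw [e]
    exact hb

/-- The action of `H` on the coinvariant algebra induced by its action on polynomial functions. -/
def coinvariantsAut : H →* (Coinvariants H ≃ₐ[ℂ] Coinvariants H) where
  toFun h := Ideal.quotientEquivAlg _ _ (MulSemiringAction.toAlgAut H ℂ (Coord V) h)
    (map_coinvariantIdeal H h)
  map_one' := by
    ext x
    obtain ⟨a, rfl⟩ := Ideal.Quotient.mk_surjective x
    exact congrArg (Ideal.Quotient.mk (coinvariantIdeal H)) (one_smul H a)
  map_mul' g h := by
    ext x
    obtain ⟨a, rfl⟩ := Ideal.Quotient.mk_surjective x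
    exact congrArg (Ideal.Quotient.mk (coinvariantIdeal H)) (mul_smul g h a)

/-- The closed point of `Co(H, V)`: evaluation at the origin. -/
def coinvariantsPoint : Coinvariants H →ₐ[ℂ] ℂ :=
  Ideal.Quotient.liftₐ (coinvariantIdeal H) (evalZero V) (fun _ ha =>
    (Ideal.span_le (I := RingHom.ker (evalZero V))).2 (fun _ hb => hb.2) ha)

end Coinvariants

/-! ### Induction -/

section Induction

variable {G : Type} [Group G] {H : Subgroup G} {R : Type} [CommRing R] [Algebra ℂ R]
  (β : H →* (R ≃ₐ[ℂ] R))

/-- For a finite group `G`, a subgroup `H` and a ring `R` of functions on an affine `H`-scheme `D`,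
the ring of functions on the balanced product `G ×_H D`: the functions on `G × D`, that is, the
functions `f : G → R`, which are invariant under `h • (g, d) = (g h⁻¹, h d)`. -/
def inducedAlgebra : Subalgebra ℂ (G → R) where
  carrier := {f | ∀ (h : H) (g : G), f (g * (h : G)⁻¹) = β h (f g)}
  mul_mem' {a b} ha hb h g := by simp only [Pi.mul_apply, ha h g, hb h g, map_mul]
  add_mem' {a b} ha hb h g := by simp only [Pi.add_apply, ha h g, hb h g, map_add]
  algebraMap_mem' c h g := ((β h).commutes c).symm

/-- The left translation action `(g • f)(x) = f(g⁻¹ x)` on functions on `G ×_H D`, which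
corresponds to the action `g • (x, d) = (g x, d)` on `G ×_H D`. -/
def inducedAut : G →* (inducedAlgebra β ≃ₐ[ℂ] inducedAlgebra β) where
  toFun g :=
    { toFun f := ⟨fun x => f.1 (g⁻¹ * x), fun h x =>
        (congrArg f.1 (mul_assoc _ _ _).symm).trans (f.2 h (g⁻¹ * x))⟩
      invFun f := ⟨fun x => f.1 (g * x), fun h x =>
        (congrArg f.1 (mul_assoc _ _ _).symm).trans (f.2 h (g * x))⟩
      left_inv f := Subtype.ext (funext fun x => by simp)
      right_inv f := Subtype.ext (funext fun x => by simp)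
      map_mul' _ _ := rfl
      map_add' _ _ := rfl
      commutes' _ := rfl }
  map_one' := by
    ext f x
    simp
  map_mul' g k := by
    refine AlgEquiv.ext fun f => Subtype.ext (funext fun x => congrArg f.1 ?_)
    rw [mul_inv_rev, mul_assoc]

/-- The balanced product `ind_H^G D = G ×_H D` for `D = Spec R`, with its left action of `G`. -/
def induced : Action (Over (Spec (.of ℂ))) G := specAction (inducedAut β)

/-- The point `(1, ε)` of `G ×_H D` for a point `ε` of `D`. -/
def inducedPoint (ε : R →ₐ[ℂ] ℂ) : Over.mk (𝟙 (Spec (.of ℂ))) ⟶ (induced β).V :=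
  specSection
    (ε.comp ((Pi.evalAlgHom ℂ (fun _ : G => R) 1).comp (inducedAlgebra β).val))

end Induction

section InducedCo

variable {V : Type} [AddCommGroup V] [Module ℂ V] (W : Subgroup (V ≃ₗ[ℂ] V))

/-- The `W`-scheme `ind_{W_X}^W Co(W_X, V)`. -/
def indCo (X : Submodule ℂ V) : Action (Over (Spec (.of ℂ))) W :=
  induced (coinvariantsAut (pointwiseStabilizer W X))

/-- The section of `ind_{W_X}^W Co(W_X, V)` induced from the closed point of `Co(W_X, V)`. -/
def indCoPt (X : Submodule ℂ V) : Over.mk (𝟙 (Spec (.of ℂ))) ⟶ (indCo W X).V :=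
  inducedPoint (coinvariantsAut (pointwiseStabilizer W X))
    (coinvariantsPoint (pointwiseStabilizer W X))

end InducedCo

end Cameral

end

/-! A nonempty étale scheme over `ℂ` has a `ℂ`-point, so pulling back along it shows that a cameral
cover of `Spec ℂ` is a fibre of `V → V/W` over a `ℂ`-point
(`exists_iso_pullback_of_isCameralCover`). By integrality that point is the image of some `v` in `V`
(`exists_evalAt_eq_on_invariants`).

If `H` is the stabilizer of `v`, the fibre is `W ×_H (v + Co(H, V))`: near `v` the quotient by `W`
looks like the quotient by `H`, and translation by `v` commutes with `H`. In algebra, the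
restriction map `fibreHom` is surjective (`fibreHom_surjective`) and its kernel is the ideal of the
fibre (`mem_fibreIdeal_of_fibreHom_eq_zero`).

It remains to compare stabilizers with the groups `W_X`. A generic point of `X` has stabilizer
`W_X`, so every `X` occurs. Conversely, by Steinberg's theorem the stabilizer of `v` is generated by
the reflections in it, hence is `W_X` for `X` the intersection of the mirrors through `v`. The core
is `mem_of_smul_eq_of_reflections_mem`: since polynomials are flat over the invariants
(`flat_invariants`), a purity argument reduces the matter to generic points of hypersurfaces, where
only reflections can have fixed points.

Finally, sections of the fibre are points of the orbit of `v`, and `W_X`, which determines `X`, is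
the stabilizer of the distinguished one. A pointed isomorphism therefore remembers `X`. An unpointed
one may move the point along the orbit, which replaces `X` by a translate; and translates of `X`
give fibres over the same point of `V/W`. -/

noncomputable section
namespace Cameral

/-! ### Polynomial functions on a finite-dimensional space -/

section Polynomials

variable {V : Type} [AddCommGroup V] [Module ℂ V]

/-- Evaluation of polynomial functions at a point. -/
def evalAt (v : V) : Coord V →ₐ[ℂ] ℂ := SymmetricAlgebra.lift (Module.Dual.eval ℂ V v)

@[simp]
theorem evalAt_ι (v : V) (ξ : Module.Dual ℂ V) :
    evalAt v (SymmetricAlgebra.ι ℂ (Module.Dual ℂ V) ξ) = ξ v :=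
  SymmetricAlgebra.lift_ι_apply _ ξ

theorem evalAt_zero : evalAt (0 : V) = evalZero V :=
  SymmetricAlgebra.algHom_ext (LinearMap.ext fun ξ =>
    (evalAt_ι 0 ξ).trans ((map_zero ξ).trans (SymmetricAlgebra.algebraMapInv_ι ξ).symm))

theorem evalAt_comp_coordHom (g : V ≃ₗ[ℂ] V) (v : V) :
    (evalAt v).comp (coordHom g) = evalAt (g⁻¹ v) := by
  refine SymmetricAlgebra.algHom_ext (LinearMap.ext fun ξ => ?_)
  exact (congrArg (evalAt v) (coordHom_ι g ξ)).trans
    ((evalAt_ι _ _).trans (evalAt_ι (g⁻¹ v) ξ).symm)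

theorem evalAt_smul (g : V ≃ₗ[ℂ] V) (v : V) (a : Coord V) :
    evalAt v (g • a) = evalAt (g⁻¹ v) a :=
  DFunLike.congr_fun (evalAt_comp_coordHom g v) a

/-- Translation by `v` of polynomial functions, `f ↦ f(· + v)`. -/
def translate (v : V) : Coord V →ₐ[ℂ] Coord V :=
  SymmetricAlgebra.lift (SymmetricAlgebra.ι ℂ (Module.Dual ℂ V) +
    Algebra.linearMap ℂ (Coord V) ∘ₗ Module.Dual.eval ℂ V v)

theorem translate_ι (v : V) (ξ : Module.Dual ℂ V) :
    translate v (SymmetricAlgebra.ι ℂ (Module.Dual ℂ V) ξ) =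
      SymmetricAlgebra.ι ℂ (Module.Dual ℂ V) ξ + algebraMap ℂ (Coord V) (ξ v) :=
  SymmetricAlgebra.lift_ι_apply _ ξ

theorem translate_add (v w : V) (a : Coord V) :
    translate v (translate w a) = translate (v + w) a := by
  refine DFunLike.congr_fun (f := (translate v).comp (translate w)) (SymmetricAlgebra.algHom_ext
    (LinearMap.ext fun ξ => ?_)) a
  refine (congrArg (translate v) (translate_ι w ξ)).trans (Eq.trans ?_ (translate_ι (v + w) ξ).symm)
  rw [map_add, translate_ι, AlgHom.commutes, map_add, map_add, add_assoc]

theorem translate_zero (a : Coord V) : translate 0 a = a := by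
  refine DFunLike.congr_fun (g := AlgHom.id ℂ (Coord V)) (SymmetricAlgebra.algHom_ext
    (LinearMap.ext fun ξ => ?_)) a
  refine (translate_ι 0 ξ).trans ?_
  simp

theorem evalAt_translate (v w : V) (a : Coord V) :
    evalAt w (translate v a) = evalAt (w + v) a := by
  refine DFunLike.congr_fun (f := (evalAt w).comp (translate v)) (SymmetricAlgebra.algHom_ext
    (LinearMap.ext fun ξ => ?_)) a
  refine (congrArg (evalAt w) (translate_ι v ξ)).trans (Eq.trans ?_ (evalAt_ι (w + v) ξ).symm)
  simp

/-- This moves invariants of the stabilizer of `v` from a neighbourhood of `v` to one of the origin,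
where the coinvariant ideal lives. -/
theorem translate_smul (g : V ≃ₗ[ℂ] V) {v : V} (hv : g v = v) (a : Coord V) :
    translate v (g • a) = g • translate v a := by
  refine DFunLike.congr_fun (f := (translate v).comp (coordHom g))
    (g := (coordHom g).comp (translate v)) (SymmetricAlgebra.algHom_ext
    (LinearMap.ext fun ξ => ?_)) a
  refine (congrArg (translate v) (coordHom_ι g ξ)).trans (Eq.trans ?_
    (congrArg (coordHom g) (translate_ι v ξ)).symm)
  rw [translate_ι, map_add, coordHom_ι, AlgHom.commutes]
  have : (g⁻¹ : V ≃ₗ[ℂ] V) v = v := by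
    conv_lhs => rw [← hv]
    exact g.symm_apply_apply v
  congr 2
  exact congrArg ξ this

theorem ι_injective : Function.Injective (SymmetricAlgebra.ι ℂ (Module.Dual ℂ V)) := by
  intro ξ η h
  ext v
  rw [← evalAt_ι, ← evalAt_ι, h]

variable [FiniteDimensional ℂ V]

/-- Restricted to linear forms, `ψ` is an element of the double dual, which is `V` in finite
dimension. -/
theorem exists_evalAt_eq (ψ : Coord V →ₐ[ℂ] ℂ) : ∃ v, ψ = evalAt v := by
  refine ⟨(Module.evalEquiv ℂ V).symm
    (ψ.toLinearMap ∘ₗ SymmetricAlgebra.ι ℂ (Module.Dual ℂ V)), ?_⟩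
  refine SymmetricAlgebra.algHom_ext (LinearMap.ext fun ξ => ?_)
  refine Eq.trans ?_ (evalAt_ι _ ξ).symm
  rw [Module.apply_evalEquiv_symm_apply]
  rfl

variable (V) in
/-- Linear coordinates identify polynomial functions with polynomials. -/
def coordEquiv : Coord V ≃ₐ[ℂ] MvPolynomial (Fin (Module.finrank ℂ (Module.Dual ℂ V))) ℂ :=
  SymmetricAlgebra.equivMvPolynomial (Module.finBasis ℂ (Module.Dual ℂ V))

instance : IsDomain (Coord V) := (coordEquiv V).toMulEquiv.isDomain _

instance : UniqueFactorizationMonoid (Coord V) :=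
  (coordEquiv V).symm.toMulEquiv.uniqueFactorizationMonoid inferInstance

theorem exists_evalAt_eq_aeval (x : Fin (Module.finrank ℂ (Module.Dual ℂ V)) → ℂ) :
    ∃ v : V, ∀ a, evalAt v a = MvPolynomial.aeval x (coordEquiv V a) := by
  obtain ⟨v, hv⟩ := exists_evalAt_eq ((MvPolynomial.aeval x).comp
    (coordEquiv V : Coord V →ₐ[ℂ] MvPolynomial (Fin (Module.finrank ℂ (Module.Dual ℂ V))) ℂ))
  exact ⟨v, fun a => (DFunLike.congr_fun hv a).symm⟩

/-- A polynomial function that vanishes on the zero locus of a prime polynomial `p` is a multiple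
of `p`. -/
theorem dvd_of_evalAt_eq_zero {p q : Coord V} (hp : Prime p)
    (h : ∀ v, evalAt v p = 0 → evalAt v q = 0) : p ∣ q := by
  have hp' : Prime (coordEquiv V p) := (MulEquiv.prime_iff (coordEquiv V).toMulEquiv).2 hp
  have hpr : (Ideal.span {coordEquiv V p}).IsPrime :=
    (Ideal.span_singleton_prime hp'.ne_zero).2 hp'
  have hq : coordEquiv V q ∈ Ideal.span {coordEquiv V p} := by
    -- The Nullstellensatz for the prime ideal generated by `p`.
    rw [← MvPolynomial.IsPrime.vanishingIdeal_zeroLocus (K := ℂ) (Ideal.span {coordEquiv V p}),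
      MvPolynomial.mem_vanishingIdeal_iff]
    intro x hx
    obtain ⟨v, hv⟩ := exists_evalAt_eq_aeval (V := V) x
    rw [← hv]
    refine h v ?_
    rw [hv]
    exact hx _ (Ideal.mem_span_singleton_self _)
  exact (map_dvd_iff (coordEquiv V)).1 (Ideal.mem_span_singleton.1 hq)

theorem exists_evalAt_ne_zero {a : Coord V} (ha : a ≠ 0) : ∃ v, evalAt v a ≠ 0 := by
  by_contra! h
  refine ha ((coordEquiv V).injective (MvPolynomial.funext fun x => ?_))
  obtain ⟨v, hv⟩ := exists_evalAt_eq_aeval (V := V) x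
  have := h v
  rw [hv, MvPolynomial.aeval_eq_eval] at this
  rw [map_zero, map_zero]
  exact this

theorem totalDegree_coordEquiv_ι (ξ : Module.Dual ℂ V) :
    (coordEquiv V (SymmetricAlgebra.ι ℂ (Module.Dual ℂ V) ξ)).totalDegree ≤ 1 := by
  rw [← MvPolynomial.mem_restrictTotalDegree]
  rw [← (Module.finBasis ℂ (Module.Dual ℂ V)).sum_repr ξ, map_sum, map_sum]
  refine Submodule.sum_mem _ fun i _ => ?_
  rw [map_smul, map_smul, coordEquiv, SymmetricAlgebra.equivMvPolynomial_ι_apply]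
  refine Submodule.smul_mem _ _ ?_
  rw [MvPolynomial.mem_restrictTotalDegree, MvPolynomial.totalDegree_X]

/-- A linear form is, up to scalars, its only prime divisor. -/
theorem exists_smul_eq_of_prime_dvd_ι {p : Coord V} (hp : Prime p) {ξ : Module.Dual ℂ V}
    (h : p ∣ SymmetricAlgebra.ι ℂ (Module.Dual ℂ V) ξ) :
    ∃ k : ℂ, SymmetricAlgebra.ι ℂ (Module.Dual ℂ V) ξ = k • p := by
  obtain ⟨c, hc⟩ := h
  rcases eq_or_ne c 0 with rfl | hc0
  · exact ⟨0, by rw [hc, mul_zero, zero_smul]⟩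
  -- Degrees add over a domain and a prime has positive degree, so the cofactor `c` is constant.
  have hd := totalDegree_coordEquiv_ι ξ
  rw [hc, map_mul, MvPolynomial.totalDegree_mul_of_isDomain
    ((map_ne_zero_iff _ (coordEquiv V).injective).2 hp.ne_zero)
    ((map_ne_zero_iff _ (coordEquiv V).injective).2 hc0)] at hd
  have hp1 : (coordEquiv V p).totalDegree ≠ 0 := by
    intro h0
    rw [MvPolynomial.totalDegree_eq_zero_iff_eq_C] at h0
    have hk : MvPolynomial.coeff 0 (coordEquiv V p) ≠ 0 := by
      intro hk
      rw [hk, map_zero] at h0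
      exact hp.ne_zero ((map_eq_zero_iff _ (coordEquiv V).injective).1 h0)
    apply hp.not_isUnit
    rw [← MulEquiv.isUnit_map (coordEquiv V)]
    rw [h0]
    exact (IsUnit.mk0 _ hk).map MvPolynomial.C
  have hc1 : (coordEquiv V c).totalDegree = 0 := by omega
  rw [MvPolynomial.totalDegree_eq_zero_iff_eq_C] at hc1
  refine ⟨MvPolynomial.coeff 0 (coordEquiv V c), ?_⟩
  apply (coordEquiv V).injective
  rw [hc, map_mul, hc1, map_smul, MvPolynomial.coeff_C, if_pos rfl, mul_comm,
    MvPolynomial.C_mul']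

/-- Polynomial functions separate a point from a finite set of other points. -/
theorem exists_evalAt_eq_one_of_notMem (S : Finset V) {x : V} (hx : x ∉ S) :
    ∃ a : Coord V, evalAt x a = 1 ∧ ∀ y ∈ S, evalAt y a = 0 := by
  have h : ∀ y ∈ S, ∃ a : Coord V, evalAt x a = 1 ∧ evalAt y a = 0 := by
    intro y hy
    have hne : x - y ≠ 0 := fun h => hx (sub_eq_zero.1 h ▸ hy)
    obtain ⟨ξ, hξ⟩ : ∃ ξ : Module.Dual ℂ V, ξ (x - y) ≠ 0 := by
      by_contra! h0
      exact hne ((Module.forall_dual_apply_eq_zero_iff ℂ _).1 h0)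
    refine ⟨(ξ (x - y))⁻¹ • (SymmetricAlgebra.ι ℂ (Module.Dual ℂ V) ξ -
      algebraMap ℂ (Coord V) (ξ y)), ?_, ?_⟩
    · rw [map_smul, map_sub (evalAt x), evalAt_ι, AlgHom.commutes, Algebra.algebraMap_self_apply,
        ← map_sub, smul_eq_mul, inv_mul_cancel₀ hξ]
    · rw [map_smul, map_sub (evalAt y), evalAt_ι, AlgHom.commutes, Algebra.algebraMap_self_apply,
        sub_self, smul_zero]
  choose! a ha using h
  refine ⟨∏ y ∈ S, a y, ?_, fun y hy => ?_⟩
  · rw [map_prod]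
    exact Finset.prod_eq_one fun y hy => (ha y hy).1
  · rw [map_prod]
    exact Finset.prod_eq_zero hy (ha y hy).2

end Polynomials

/-! ### Flatness of polynomials over the invariants of a reflection group -/

section Flatness

variable {V : Type} [AddCommGroup V] [Module ℂ V]

variable (V) in
/-- The space of polynomial functions of degree at most one. -/
def affineForms : Submodule ℂ (Coord V) :=
  1 ⊔ LinearMap.range (SymmetricAlgebra.ι ℂ (Module.Dual ℂ V))

theorem affineForms_pow_le {m n : ℕ} (h : m ≤ n) : affineForms V ^ m ≤ affineForms V ^ n :=
  pow_le_pow_right₀ le_sup_left h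

/-- The powers of `affineForms V` filter by degree; this exhaustion provides the induction on degree
for flatness. -/
theorem exists_mem_affineForms_pow (a : Coord V) : ∃ d, a ∈ affineForms V ^ d := by
  induction a using SymmetricAlgebra.induction with
  | algebraMap r => exact ⟨0, by rw [pow_zero]; exact Submodule.algebraMap_mem r⟩
  | ι x => exact ⟨1, by rw [pow_one]; exact Submodule.mem_sup_right ⟨x, rfl⟩⟩
  | mul a b ha hb =>
    obtain ⟨m, hm⟩ := ha
    obtain ⟨n, hn⟩ := hb
    exact ⟨m + n, by rw [pow_add]; exact Submodule.mul_mem_mul hm hn⟩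
  | add a b ha hb =>
    obtain ⟨m, hm⟩ := ha
    obtain ⟨n, hn⟩ := hb
    exact ⟨max m n, Submodule.add_mem _ (affineForms_pow_le (le_max_left _ _) hm)
      (affineForms_pow_le (le_max_right _ _) hn)⟩

theorem smul_mem_affineForms (g : V ≃ₗ[ℂ] V) {a : Coord V} (ha : a ∈ affineForms V) :
    g • a ∈ affineForms V := by
  obtain ⟨b, hb, _, ⟨ξ, rfl⟩, rfl⟩ := Submodule.mem_sup.1 ha
  obtain ⟨c, rfl⟩ := Submodule.mem_one.1 hb
  rw [smul_add]
  refine Submodule.add_mem _ (Submodule.mem_sup_left ?_) (Submodule.mem_sup_right ?_)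
  · rw [smul_coord_def, AlgHom.commutes]
    exact Submodule.algebraMap_mem c
  · rw [smul_coord_def, coordHom_ι]
    exact ⟨_, rfl⟩

/-- A hyperplane is the kernel of a linear form, and the forms vanishing on it are its multiples. -/
theorem exists_ker_eq_of_isCoatom {X : Submodule ℂ V} (hX : IsCoatom X) :
    ∃ α : Module.Dual ℂ V, α ≠ 0 ∧ LinearMap.ker α = X ∧
      ∀ η : Module.Dual ℂ V, (∀ x ∈ X, η x = 0) → ∃ c : ℂ, η = c • α := by
  obtain ⟨α, hα, hle⟩ := Submodule.exists_le_ker_of_lt_top X hX.lt_top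
  have hker : LinearMap.ker α = X :=
    (hX.le_iff_eq (fun h => hα (LinearMap.ker_eq_top.1 h))).1 hle
  refine ⟨α, hα, hker, fun η hη => ?_⟩
  obtain ⟨y, hy⟩ : ∃ y, α y ≠ 0 := by
    by_contra! h
    exact hα (LinearMap.ext h)
  refine ⟨η y / α y, LinearMap.ext fun x => ?_⟩
  have hx : x - (α x / α y) • y ∈ X := by
    rw [← hker, LinearMap.mem_ker, map_sub, map_smul, smul_eq_mul, div_mul_cancel₀ _ hy, sub_self]
  have h := hη _ hx
  rw [map_sub, map_smul, sub_eq_zero] at h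
  rw [h, LinearMap.smul_apply, smul_eq_mul, smul_eq_mul]
  ring

/-- For a reflection `s` with mirror `ker α`, the polynomial `a - s • a` is a multiple of `α`, with
quotient of lower degree. -/
theorem exists_sub_smul_eq_mul {s : V ≃ₗ[ℂ] V} (hs : IsReflection s) :
    ∃ α : Module.Dual ℂ V, α ≠ 0 ∧ LinearMap.ker α = fixedSpace s ∧
      ∀ d, ∀ a ∈ affineForms V ^ (d + 1), ∃ b ∈ affineForms V ^ d,
        a - s • a = SymmetricAlgebra.ι ℂ (Module.Dual ℂ V) α * b := by
  obtain ⟨α, hα, hker, hη⟩ := exists_ker_eq_of_isCoatom hs.2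
  refine ⟨α, hα, hker, fun d => ?_⟩
  have h1 : ∀ a ∈ affineForms V, ∃ c : ℂ,
      a - s • a = SymmetricAlgebra.ι ℂ (Module.Dual ℂ V) α * algebraMap ℂ (Coord V) c := by
    intro a ha
    obtain ⟨b, hb, _, ⟨ξ, rfl⟩, rfl⟩ := Submodule.mem_sup.1 ha
    obtain ⟨r, rfl⟩ := Submodule.mem_one.1 hb
    -- On linear forms, `ξ - s • ξ` vanishes on the mirror, hence is a multiple of `α`.
    obtain ⟨c, hc⟩ := hη (ξ - ((s⁻¹ : V ≃ₗ[ℂ] V) : V →ₗ[ℂ] V).dualMap ξ) (fun x hx => by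
      have hx' : s x = x := hx
      have : (s⁻¹ : V ≃ₗ[ℂ] V) x = x := by
        conv_lhs => rw [← hx']
        exact s.symm_apply_apply x
      rw [LinearMap.sub_apply, sub_eq_zero]
      exact (congrArg ξ this).symm)
    refine ⟨c, ?_⟩
    rw [smul_add, smul_coord_def, smul_coord_def, AlgHom.commutes, coordHom_ι,
      add_sub_add_left_eq_sub, ← map_sub, hc, map_smul, Algebra.smul_def, mul_comm]
  induction d with
  | zero =>
    intro a ha
    rw [zero_add, pow_one] at ha
    obtain ⟨c, hc⟩ := h1 a ha
    exact ⟨_, by rw [pow_zero]; exact Submodule.algebraMap_mem c, hc⟩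
  | succ d ih =>
    intro a ha
    rw [pow_succ'] at ha
    induction ha using Submodule.mul_induction_on' with
    | mem_mul_mem x hx y hy =>
      obtain ⟨c, hc⟩ := h1 x hx
      obtain ⟨b, hb, hyb⟩ := ih y hy
      -- Twisted Leibniz rule: `xy - s(xy) = (x - sx) y + sx (y - sy)`.
      refine ⟨c • y + (s • x) * b, Submodule.add_mem _ (Submodule.smul_mem _ c hy) ?_, ?_⟩
      · rw [pow_succ']
        exact Submodule.mul_mem_mul (smul_mem_affineForms s hx) hb
      · rw [smul_mul', Algebra.smul_def]
        linear_combination y * hc + (s • x) * hyb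
    | add x hx y hy h₁ h₂ =>
      obtain ⟨b, hb, h₁⟩ := h₁
      obtain ⟨c, hc, h₂⟩ := h₂
      refine ⟨b + c, Submodule.add_mem _ hb hc, ?_⟩
      rw [smul_add]
      linear_combination h₁ + h₂

variable (W : Subgroup (V ≃ₗ[ℂ] V))

/-- The `H`-invariant polynomial functions, as a module over the `W`-invariant ones. -/
def invariantSubmodule (H : Subgroup W) : Submodule (Invariants W) (Coord V) where
  carrier := {a | ∀ h ∈ H, h • a = a}
  add_mem' ha hb h hh := by rw [smul_add, ha h hh, hb h hh]
  zero_mem' h _ := smul_zero h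
  smul_mem' b a ha h hh := by rw [smul_comm, ha h hh]

/-- The Reynolds operator of `H`, averaging over `H`. -/
def reynolds (H : Subgroup W) [Fintype H] : Coord V →ₗ[Invariants W] Coord V :=
  algebraMap ℂ (Invariants W) (Fintype.card H : ℂ)⁻¹ •
    ∑ h : H, DistribSMul.toLinearMap (Invariants W) (Coord V) (h : W)

theorem reynolds_apply (H : Subgroup W) [Fintype H] (a : Coord V) :
    reynolds W H a = algebraMap ℂ (Invariants W) (Fintype.card H : ℂ)⁻¹ • ∑ h : H, (h : W) • a := by
  rw [reynolds, LinearMap.smul_apply, LinearMap.sum_apply]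
  rfl

theorem reynolds_mem (H : Subgroup W) [Fintype H] (a : Coord V) :
    reynolds W H a ∈ invariantSubmodule W H := by
  intro h hh
  rw [reynolds_apply, smul_comm, Finset.smul_sum]
  congr 1
  refine Fintype.sum_equiv (Equiv.mulLeft (⟨h, hh⟩ : H)) _ _ fun x => ?_
  rw [smul_smul]
  rfl

theorem reynolds_eq_self {H : Subgroup W} [Fintype H] {a : Coord V}
    (ha : a ∈ invariantSubmodule W H) : reynolds W H a = a := by
  rw [reynolds_apply, Finset.sum_congr rfl (g := fun _ => a) (fun (h : H) _ => ha (h : W) h.2),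
    Finset.sum_const,
    Finset.card_univ, ← Nat.cast_smul_eq_nsmul ℂ, algebraMap_smul, smul_smul, inv_mul_cancel₀,
    one_smul]
  exact Nat.cast_ne_zero.2 Fintype.card_ne_zero

variable {W}

/-- The quotient of `a - s • a` by a linear form defining the mirror of a reflection `s`, as an
operator that is linear over the invariants. -/
theorem exists_linearMap_sub_smul_eq_mul [FiniteDimensional ℂ V] {s : W}
    (hs : IsReflection (s : V ≃ₗ[ℂ] V)) :
    ∃ (α : Coord V) (Δ : Coord V →ₗ[Invariants W] Coord V),
      (∀ a, a - s • a = α * Δ a) ∧ (∀ a ∈ affineForms V ^ 0, Δ a = 0) ∧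
      ∀ d, ∀ a ∈ affineForms V ^ (d + 1), Δ a ∈ affineForms V ^ d := by
  obtain ⟨α, hα, -, h⟩ := exists_sub_smul_eq_mul hs
  have hα' : SymmetricAlgebra.ι ℂ (Module.Dual ℂ V) α ≠ 0 :=
    (map_ne_zero_iff _ ι_injective).2 hα
  have hdvd : ∀ a : Coord V, ∃ b, a - s • a = SymmetricAlgebra.ι ℂ (Module.Dual ℂ V) α * b := by
    intro a
    obtain ⟨d, hd⟩ := exists_mem_affineForms_pow a
    obtain ⟨b, -, hb⟩ := h d a (by
      rw [pow_succ]
      exact (mul_one a) ▸ Submodule.mul_mem_mul hd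
        (Submodule.mem_sup_left (Submodule.one_le.1 le_rfl)))
    exact ⟨b, hb⟩
  choose Δ hΔ using hdvd
  refine ⟨SymmetricAlgebra.ι ℂ (Module.Dual ℂ V) α,
    { toFun := Δ
      map_add' := fun a b => mul_left_cancel₀ hα' ?_
      map_smul' := fun b a => mul_left_cancel₀ hα' ?_ }, hΔ, fun a ha => ?_, fun d a ha => ?_⟩
  · rw [mul_add, ← hΔ, ← hΔ, ← hΔ, smul_add]
    ring
  · rw [RingHom.id_apply, mul_smul_comm, ← hΔ, ← hΔ, smul_sub, smul_comm]
  · refine mul_left_cancel₀ hα' ?_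
    rw [pow_zero] at ha
    obtain ⟨c, rfl⟩ := Submodule.mem_one.1 ha
    refine (hΔ _).symm.trans ?_
    rw [mul_zero, sub_eq_zero]
    exact ((coordHom (s : V ≃ₗ[ℂ] V)).commutes c).symm
  · obtain ⟨b, hb, hab⟩ := h d a ha
    have : b = Δ a := mul_left_cancel₀ hα' (hab.symm.trans (hΔ a))
    change Δ a ∈ affineForms V ^ d
    rw [← this]
    exact hb

open TensorProduct in
/-- Polynomial functions form a flat module over the invariants of a reflection group. -/
theorem flat_invariants [FiniteDimensional ℂ V] (hW : IsReflectionGroup W) :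
    Module.Flat (Invariants W) (Coord V) := by
  have := hW.finite
  have := Fintype.ofFinite W
  have := Fintype.ofFinite (⊤ : Subgroup W)
  -- Induction on degree in the kernel of `i ⊗ 1`. The operators `Δ` are linear over the invariants,
  -- so they preserve this kernel, and they lower degree. Once they all kill `z`, every reflection
  -- fixes `z`, hence so does `W`, and averaging finishes.
  rw [Module.Flat.iff_rTensor_preserves_injective_linearMap]
  intro N Q _ _ _ _ i hi
  rw [injective_iff_map_eq_zero]
  -- Only an additive submonoid, since the powers of `affineForms V` are not stable under
  -- multiplication by invariants.
  let T (d : ℕ) : AddSubmonoid (N ⊗[Invariants W] Coord V) :=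
    AddSubmonoid.closure {z | ∃ n : N, ∃ a ∈ affineForms V ^ d, z = n ⊗ₜ a}
  let σ (w : W) : Coord V →ₗ[Invariants W] Coord V :=
    DistribSMul.toLinearMap (Invariants W) (Coord V) w
  -- a `W`-invariant element of the kernel is zero
  have hinv : ∀ z : N ⊗[Invariants W] Coord V, i.rTensor (Coord V) z = 0 →
      (∀ w : W, (σ w).lTensor N z = z) → z = 0 := by
    intro z hz hw
    let e : Coord V →ₗ[Invariants W] Invariants W :=
      { toFun := fun a => ⟨reynolds W ⊤ a, fun w => reynolds_mem W ⊤ a w trivial⟩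
        map_add' := fun a b => Subtype.ext (map_add _ a b)
        map_smul' := fun b a => Subtype.ext (map_smul (reynolds W ⊤) b a) }
    have he : Algebra.linearMap (Invariants W) (Coord V) ∘ₗ e = reynolds W ⊤ := rfl
    have hz1 : (reynolds W ⊤).lTensor N z = z := by
      rw [reynolds, LinearMap.lTensor_smul, LinearMap.smul_apply, ← LinearMap.coe_lTensorHom,
        map_sum, LinearMap.sum_apply,
        show ∑ w : (⊤ : Subgroup W), LinearMap.lTensorHom N (σ w) z = ∑ _ : (⊤ : Subgroup W), z from
          Finset.sum_congr rfl fun w _ => hw w,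
        Finset.sum_const, Finset.card_univ, ← Nat.cast_smul_eq_nsmul (Invariants W), smul_smul,
        ← map_natCast (algebraMap ℂ (Invariants W)), ← map_mul, inv_mul_cancel₀, map_one, one_smul]
      exact Nat.cast_ne_zero.2 Fintype.card_ne_zero
    -- Averaging factors through `N ⊗ Invariants W`, where tensoring with `i` stays injective.
    have hz2 : e.lTensor N z = 0 := by
      refine Module.Flat.rTensor_preserves_injective_linearMap (M := Invariants W) i hi ?_
      rw [map_zero, ← LinearMap.comp_apply, LinearMap.rTensor_comp_lTensor,
        ← LinearMap.lTensor_comp_rTensor, LinearMap.comp_apply, hz, map_zero]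
    rw [← hz1, ← he, LinearMap.lTensor_comp, LinearMap.comp_apply, hz2, map_zero]
  -- an element of the kernel annihilated by all the operators of reflections is zero
  have hΔ : ∀ z : N ⊗[Invariants W] Coord V, i.rTensor (Coord V) z = 0 →
      (∀ s : W, ∀ (α : Coord V) (Δ : Coord V →ₗ[Invariants W] Coord V),
        (∀ a, a - s • a = α * Δ a) → (∀ a ∈ affineForms V ^ 0, Δ a = 0) →
        (∀ d, ∀ a ∈ affineForms V ^ (d + 1), Δ a ∈ affineForms V ^ d) →
        Δ.lTensor N z = 0) → z = 0 := by
    intro z hz h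
    refine hinv z hz fun w => ?_
    have hmem : (w : V ≃ₗ[ℂ] V) ∈ Subgroup.closure {r | r ∈ W ∧ IsReflection r} :=
      hW.closure_eq.symm ▸ w.2
    suffices hall : ∀ g ∈ Subgroup.closure {r | r ∈ W ∧ IsReflection r}, ∀ hg : g ∈ W,
        (σ ⟨g, hg⟩).lTensor N z = z from hall w hmem w.2
    have hmul : ∀ x y : W, (σ (x * y)).lTensor N z = (σ x).lTensor N ((σ y).lTensor N z) := by
      intro x y
      rw [← LinearMap.comp_apply, ← LinearMap.lTensor_comp]
      congr 2
      exact LinearMap.ext fun a => mul_smul x y a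
    have hone : (σ 1).lTensor N z = z := by
      have : σ 1 = LinearMap.id := LinearMap.ext fun a => one_smul W a
      rw [this, LinearMap.lTensor_id, LinearMap.id_apply]
    intro g hg
    have hsub : Subgroup.closure {r | r ∈ W ∧ IsReflection r} = W := hW.closure_eq
    induction hg using Subgroup.closure_induction with
    | mem s hs =>
      intro hsW
      obtain ⟨α, Δ, h₁, h₂, h₃⟩ := exists_linearMap_sub_smul_eq_mul (s := (⟨s, hsW⟩ : W)) hs.2
      have : σ ⟨s, hsW⟩ = LinearMap.id - LinearMap.mulLeft (Invariants W) α ∘ₗ Δ := by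
        ext a
        exact (sub_sub_cancel a _).symm.trans (congrArg (a - ·) (h₁ a))
      rw [this, LinearMap.lTensor_sub, LinearMap.lTensor_id, LinearMap.lTensor_comp,
        LinearMap.sub_apply, LinearMap.comp_apply, h _ α Δ h₁ h₂ h₃, map_zero, sub_zero,
        LinearMap.id_apply]
    | one => exact fun _ => hone
    | mul x y hx hy h₁ h₂ =>
      intro hxy
      have hx' := hsub ▸ hx
      have hy' := hsub ▸ hy
      have := hmul ⟨x, hx'⟩ ⟨y, hy'⟩
      rw [h₂ hy', h₁ hx'] at this
      exact this
    | inv x hx h₁ =>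
      intro hx'
      have hx'' := hsub ▸ hx
      have := hmul ⟨x⁻¹, hx'⟩ ⟨x, hx''⟩
      rw [h₁ hx''] at this
      rw [← this]
      refine Eq.trans ?_ hone
      congr 3
      exact Subtype.ext (inv_mul_cancel x)
  have hzero : ∀ d, ∀ z ∈ T d, ∀ f : Coord V →ₗ[Invariants W] Coord V,
      (∀ a ∈ affineForms V ^ d, f a = 0) → f.lTensor N z = 0 := by
    intro d z hz f hf
    induction hz using AddSubmonoid.closure_induction with
    | mem x hx =>
      obtain ⟨n, a, ha, rfl⟩ := hx
      rw [LinearMap.lTensor_tmul, hf a ha, TensorProduct.tmul_zero]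
    | zero => exact map_zero _
    | add x y _ _ h₁ h₂ => rw [map_add, h₁, h₂, add_zero]
  have hstep : ∀ d, ∀ z ∈ T (d + 1), ∀ f : Coord V →ₗ[Invariants W] Coord V,
      (∀ a ∈ affineForms V ^ (d + 1), f a ∈ affineForms V ^ d) → f.lTensor N z ∈ T d := by
    intro d z hz f hf
    induction hz using AddSubmonoid.closure_induction with
    | mem x hx =>
      obtain ⟨n, a, ha, rfl⟩ := hx
      rw [LinearMap.lTensor_tmul]
      exact AddSubmonoid.subset_closure ⟨n, f a, hf a ha, rfl⟩
    | zero => rw [map_zero]; exact zero_mem _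
    | add x y _ _ h₁ h₂ => rw [map_add]; exact add_mem h₁ h₂
  have hmono : Monotone T := fun m n hmn => AddSubmonoid.closure_mono (by
    rintro _ ⟨x, a, ha, rfl⟩
    exact ⟨x, a, affineForms_pow_le hmn ha, rfl⟩)
  have key : ∀ d, ∀ z ∈ T d, i.rTensor (Coord V) z = 0 → z = 0 := by
    intro d
    induction d with
    | zero => exact fun z hz hz0 => hΔ z hz0 fun s α Δ _ h₂ _ => hzero 0 z hz Δ h₂
    | succ d ih =>
      refine fun z hz hz0 => hΔ z hz0 fun s α Δ _ _ h₃ => ih _ (hstep d z hz Δ (h₃ d)) ?_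
      rw [← LinearMap.comp_apply, LinearMap.rTensor_comp_lTensor,
        ← LinearMap.lTensor_comp_rTensor, LinearMap.comp_apply, hz0, map_zero]
  intro z
  obtain ⟨d, hd⟩ : ∃ d, z ∈ T d := by
    induction z using TensorProduct.induction_on with
    | zero => exact ⟨0, zero_mem _⟩
    | tmul n a =>
      obtain ⟨d, hd⟩ := exists_mem_affineForms_pow a
      exact ⟨d, AddSubmonoid.subset_closure ⟨n, a, hd, rfl⟩⟩
    | add x y hx hy =>
      obtain ⟨m, hm⟩ := hx
      obtain ⟨n, hn⟩ := hy
      exact ⟨max m n, add_mem (hmono (le_max_left _ _) hm) (hmono (le_max_right _ _) hn)⟩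
  exact key d z hd

end Flatness

/-! ### Point stabilizers in reflection groups -/

section LocalBasis

/-- A finite flat module over a domain is free over a neighbourhood of each prime, with a basis
that consists of elements of the module. -/
theorem exists_linearIndependent_span_of_flat {R M : Type*} [CommRing R] [IsDomain R]
    [AddCommGroup M] [Module R M] [Module.Finite R M] [Module.Flat R M] (p : Ideal R)
    [p.IsPrime] :
    ∃ (n : ℕ) (e : Fin n → M) (s : R), s ∉ p ∧ (∀ m, s • m ∈ Submodule.span R (Set.range e)) ∧
      ∀ c : Fin n → R, ∑ i, c i • e i = 0 → c = 0 := by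
  classical
  let f := LocalizedModule.mkLinearMap p.primeCompl M
  -- A finite flat module over a local ring is free. Clearing denominators turns a basis into
  -- elements of `M`, and the finitely many generators of `M` need one common denominator `s`.
  have : Module.Free (Localization.AtPrime p) (LocalizedModule p.primeCompl M) :=
    Module.free_of_flat_of_isLocalRing
  let b := Module.finBasis (Localization.AtPrime p) (LocalizedModule p.primeCompl M)
  have h1 : ∀ i, ∃ (m : M) (t : p.primeCompl),
      algebraMap R (Localization.AtPrime p) t • b i = f m := by
    intro i
    obtain ⟨⟨m, t⟩, h⟩ := IsLocalizedModule.mk'_surjective p.primeCompl f (b i)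
    refine ⟨m, t, ?_⟩
    rw [← h, algebraMap_smul]
    exact IsLocalizedModule.mk'_cancel' f m t
  choose e t het using h1
  let b' := b.isUnitSMul (w := fun i => algebraMap R (Localization.AtPrime p) (t i))
    (fun i => IsLocalization.map_units _ (t i))
  have hb' : ∀ i, b' i = f (e i) := fun i => by
    rw [Module.Basis.isUnitSMul_apply, het]
  have hspan : ∀ m, ∃ s : R, s ∉ p ∧ s • m ∈ Submodule.span R (Set.range e) := by
    intro m
    obtain ⟨u, hu⟩ := IsLocalization.exist_integer_multiples_of_finite p.primeCompl
      (fun i => b'.repr (f m) i)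
    choose c hc using hu
    have h2 : f ((u : R) • m) = f (∑ i, c i • e i) := by
      rw [map_smul, map_sum, ← b'.sum_repr (f m), Finset.smul_sum]
      refine Finset.sum_congr rfl fun i _ => ?_
      rw [map_smul, ← smul_assoc, ← hc i, algebraMap_smul, hb']
    obtain ⟨v, hv⟩ := IsLocalizedModule.exists_of_eq (S := p.primeCompl) h2
    refine ⟨v * u, (v * u).2, ?_⟩
    rw [mul_smul]
    refine Set.mem_of_eq_of_mem hv ?_
    exact Submodule.smul_mem _ _ (Submodule.sum_mem _ fun i _ =>
      Submodule.smul_mem _ _ (Submodule.subset_span ⟨i, rfl⟩))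
  choose s hs hsm using hspan
  obtain ⟨G, hG⟩ := Module.Finite.fg_top (R := R) (M := M)
  refine ⟨_, e, ∏ g ∈ G, s g, ?_, fun m => ?_, fun c hc => ?_⟩
  · rw [Ideal.IsPrime.prod_mem_iff]
    push Not
    exact fun g _ => hs g
  · have hm : m ∈ Submodule.span R (G : Set M) := hG ▸ Submodule.mem_top
    induction hm using Submodule.span_induction with
    | mem x hx =>
      rw [← Finset.prod_erase_mul _ _ hx, mul_smul]
      exact Submodule.smul_mem _ _ (hsm x)
    | zero => rw [smul_zero]; exact zero_mem _
    | add x y _ _ h₁ h₂ => rw [smul_add]; exact add_mem h₁ h₂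
    | smul r x _ h => rw [smul_comm]; exact Submodule.smul_mem _ _ h
  · have h3 : ∑ i, algebraMap R (Localization.AtPrime p) (c i) • b' i = 0 := by
      rw [← map_zero f, ← hc, map_sum]
      exact Finset.sum_congr rfl fun i _ => by rw [hb', map_smul, algebraMap_smul]
    have h4 := Fintype.linearIndependent_iff.1 b'.linearIndependent _ h3
    funext i
    exact (IsLocalization.injective (Localization.AtPrime p)
      p.primeCompl_le_nonZeroDivisors) ((h4 i).trans (map_zero _).symm)

end LocalBasis

/-! ### Separation of orbit points by invariants, and the trace form -/

section Steinberg

variable {V : Type} [AddCommGroup V] [Module ℂ V] {W : Subgroup (V ≃ₗ[ℂ] V)}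

theorem evalAt_subgroup_smul (w : W) (v : V) (a : Coord V) :
    evalAt v (w • a) = evalAt ((w⁻¹ : W) • v) a :=
  evalAt_smul (w : V ≃ₗ[ℂ] V) v a

theorem evalAt_invariant_smul (w : W) (v : V) (b : Invariants W) :
    evalAt (w • v) (b : Coord V) = evalAt v (b : Coord V) := by
  rw [← inv_inv w, ← evalAt_subgroup_smul, b.2]

theorem exists_form_vanishing_on_fixedSpace {g : V ≃ₗ[ℂ] V} (hg : g ≠ 1) :
    ∃ η : Module.Dual ℂ V, η ≠ 0 ∧ ∀ x, g x = x → η x = 0 := by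
  have : fixedSpace g < ⊤ := by
    refine lt_top_iff_ne_top.2 fun h => hg (LinearEquiv.ext fun x => ?_)
    have hx : x ∈ fixedSpace g := h ▸ Submodule.mem_top
    exact hx
  obtain ⟨η, h0, hle⟩ := Submodule.exists_le_ker_of_lt_top _ this
  exact ⟨η, h0, fun x hx => hle hx⟩

variable [FiniteDimensional ℂ V]

instance : Algebra.IsInvariant (Invariants W) (Coord V) W :=
  ⟨fun a ha => ⟨⟨a, ha⟩, rfl⟩⟩

instance : Algebra.FiniteType ℂ (Coord V) :=
  Algebra.FiniteType.equiv inferInstance (coordEquiv V).symm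

instance finite_invariants [Finite W] : Module.Finite (Invariants W) (Coord V) := by
  have : Algebra.IsIntegral (Invariants W) (Coord V) :=
    Algebra.IsInvariant.isIntegral (Invariants W) (Coord V) W
  have : Algebra.FiniteType (Invariants W) (Coord V) :=
    Algebra.FiniteType.of_restrictScalars_finiteType ℂ _ _
  exact Algebra.IsIntegral.finite

/-- Multiply `a` by one nonzero linear form for each `w ≠ 1`, vanishing on the fixed space of `w`,
and take a point where the product does not vanish. -/
theorem exists_evalAt_ne_zero_and_smul_ne [Finite W] {a : Coord V} (ha : a ≠ 0) :
    ∃ x : V, evalAt x a ≠ 0 ∧ ∀ w : W, w ≠ 1 → w • x ≠ x := by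
  classical
  have := Fintype.ofFinite W
  have h : ∀ w : W, w ≠ 1 → ∃ η : Module.Dual ℂ V, η ≠ 0 ∧ ∀ x, w • x = x → η x = 0 :=
    fun w hw => exists_form_vanishing_on_fixedSpace (g := (w : V ≃ₗ[ℂ] V))
      (fun h => hw (Subtype.ext h))
  choose! η hη0 hη using h
  obtain ⟨x, hx⟩ := exists_evalAt_ne_zero (a := a * ∏ w ∈ Finset.univ.erase (1 : W),
    SymmetricAlgebra.ι ℂ (Module.Dual ℂ V) (η w)) (mul_ne_zero ha (Finset.prod_ne_zero_iff.2
      fun w hw => (map_ne_zero_iff _ ι_injective).2 (hη0 w (Finset.ne_of_mem_erase hw))))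
  rw [map_mul, map_prod, mul_ne_zero_iff, Finset.prod_ne_zero_iff] at hx
  refine ⟨x, hx.1, fun w hw hwx => hx.2 w (Finset.mem_erase.2 ⟨hw, Finset.mem_univ w⟩) ?_⟩
  rw [evalAt_ι]
  exact hη w hw x hwx

/-- Polynomial functions separate a point from the other points of its orbit. -/
theorem exists_evalAt_orbit [Finite W] (x : V) :
    ∃ a : Coord V, evalAt x a = 1 ∧ ∀ w : W, w • x ≠ x → evalAt (w • x) a = 0 := by
  classical
  have := Fintype.ofFinite W
  obtain ⟨a, h1, h2⟩ := exists_evalAt_eq_one_of_notMem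
    ((Finset.univ.image (fun w : W => w • x)).erase x) (Finset.notMem_erase x _)
  exact ⟨a, h1, fun w hw => h2 _ (Finset.mem_erase.2
    ⟨hw, Finset.mem_image.2 ⟨w, Finset.mem_univ w, rfl⟩⟩)⟩

/-- The trace form of polynomial functions over the invariants is nondegenerate. -/
theorem eq_zero_of_sum_smul_mul_eq_zero [Fintype W] {a : Coord V}
    (h : ∀ t : Coord V, ∑ w : W, w • (t * a) = 0) : a = 0 := by
  by_contra ha
  obtain ⟨x, hxa, hx⟩ := exists_evalAt_ne_zero_and_smul_ne (W := W) ha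
  -- With `t` equal to 1 at `x` and 0 on the rest of its free orbit, the trace of `t * a` at `x` is
  -- `a(x)`.
  obtain ⟨t, ht1, ht⟩ := exists_evalAt_orbit (W := W) x
  have := congrArg (evalAt x) (h t)
  rw [map_sum, map_zero, Finset.sum_eq_single (1 : W), one_smul, map_mul, ht1, one_mul] at this
  · exact hxa this
  · intro w _ hw
    rw [evalAt_subgroup_smul, map_mul, ht _ (hx _ (inv_ne_one.2 hw)), zero_mul]
  · exact fun h => (h (Finset.mem_univ _)).elim

/-- Functions that are linearly independent over the invariants have linearly independent vectors
of conjugates. -/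
theorem eq_zero_of_forall_sum_smul_mul_eq_zero [Finite W] {n : ℕ} {e : Fin n → Coord V}
    (he : ∀ c : Fin n → Invariants W, ∑ j, c j • e j = 0 → c = 0) {a : Fin n → Coord V}
    (ha : ∀ w : W, ∑ j, (w • e j) * a j = 0) : a = 0 := by
  have := Fintype.ofFinite W
  funext i
  refine eq_zero_of_sum_smul_mul_eq_zero (W := W) fun t => ?_
  let c (j : Fin n) : Invariants W := ⟨∑ w : W, w • (t * a j), fun u => by
    rw [Finset.smul_sum]
    refine Fintype.sum_equiv (Equiv.mulLeft u) _ _ fun x => ?_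
    rw [smul_smul]
    rfl⟩
  -- The sum `∑ j, c j • e j` is the sum over `w` of `w` applied to `t * ∑ j, (w⁻¹ • e j) * a j`,
  -- which is zero.
  have hc : c = 0 := he c (by
    have h1 : ∀ w : W, ∑ j, (w • (t * a j)) * e j = 0 := by
      intro w
      have h2 := congrArg (fun z => w • (t * z)) (ha w⁻¹)
      simp only [mul_zero, smul_zero, Finset.mul_sum, Finset.smul_sum] at h2
      rw [← h2]
      refine Finset.sum_congr rfl fun j _ => ?_
      rw [smul_mul', smul_mul', smul_mul', smul_inv_smul]
      ring
    calc ∑ j, c j • e j = ∑ j, ∑ w : W, (w • (t * a j)) * e j :=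
          Finset.sum_congr rfl fun j _ => Finset.sum_mul _ _ _
      _ = 0 := by
          rw [Finset.sum_comm]
          exact Finset.sum_eq_zero fun w _ => h1 w)
  exact congrArg Subtype.val (congrFun hc i)

/-- An `N`-invariant polynomial function separates a point from an `N`-inequivalent point of its
orbit. -/
theorem exists_mem_invariantSubmodule_evalAt_ne [Finite W] {N : Subgroup W} {x : V} {u : W}
    (hu : ∀ n ∈ N, n • u • x ≠ x) :
    ∃ c ∈ invariantSubmodule W N, evalAt x c ≠ evalAt (u • x) c := by
  classical
  have := Fintype.ofFinite W
  have := Fintype.ofFinite N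
  obtain ⟨a, h1, h2⟩ := exists_evalAt_orbit (W := W) x
  -- At `x` this sum counts the elements of `N` fixing `x`, a positive number; at `u • x` every term
  -- vanishes.
  refine ⟨∑ n : N, (n : W) • a, fun h hh => ?_, ?_⟩
  · rw [Finset.smul_sum]
    refine Fintype.sum_equiv (Equiv.mulLeft (⟨h, hh⟩ : N)) _ _ fun x => ?_
    rw [smul_smul]
    rfl
  · have hr : evalAt (u • x) (∑ n : N, (n : W) • a) = 0 := by
      rw [map_sum]
      refine Finset.sum_eq_zero fun n _ => ?_
      rw [evalAt_subgroup_smul]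
      have h := hu _ (N.inv_mem n.2)
      rw [smul_smul] at h ⊢
      exact h2 _ h
    have hl : evalAt x (∑ n : N, (n : W) • a) =
        ((Finset.univ.filter fun n : N => (n : W)⁻¹ • x = x).card : ℂ) := by
      rw [map_sum, Finset.card_filter, Nat.cast_sum]
      refine Finset.sum_congr rfl fun n _ => ?_
      rw [evalAt_subgroup_smul]
      split_ifs with h
      · rw [h, h1, Nat.cast_one]
      · rw [h2 _ h, Nat.cast_zero]
    rw [hr, hl, Nat.cast_ne_zero, Finset.card_ne_zero]
    exact ⟨1, Finset.mem_filter.2 ⟨Finset.mem_univ _, by simp⟩⟩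

end Steinberg

/-! ### Steinberg's theorem by purity -/

section Stabilizers

variable {V : Type} [AddCommGroup V] [Module ℂ V] {W : Subgroup (V ≃ₗ[ℂ] V)}

theorem invariantSubmodule_mul_mem {N : Subgroup W} {a b : Coord V}
    (ha : a ∈ invariantSubmodule W N) (hb : b ∈ invariantSubmodule W N) :
    a * b ∈ invariantSubmodule W N := fun h hh => by rw [smul_mul', ha h hh, hb h hh]

variable [FiniteDimensional ℂ V]

theorem exists_prime_dvd_evalAt_eq_zero {d : Coord V} (hd : d ≠ 0) {v : V}
    (hv : evalAt v d = 0) : ∃ p, Prime p ∧ p ∣ d ∧ evalAt v p = 0 := by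
  obtain ⟨f, hf, hfd⟩ := UniqueFactorizationMonoid.exists_prime_factors d hd
  have h0 : evalAt v f.prod = 0 := by
    obtain ⟨u, hu⟩ := hfd
    rw [← hu, map_mul, mul_eq_zero] at hv
    exact hv.resolve_right ((u.isUnit.map (evalAt v)).ne_zero)
  rw [map_multiset_prod, Multiset.prod_eq_zero_iff, Multiset.mem_map] at h0
  obtain ⟨p, hp, hpv⟩ := h0
  exact ⟨p, hf p hp, (Multiset.dvd_prod hp).trans hfd.dvd, hpv⟩

/-- A prime polynomial does not divide all linear forms vanishing on the fixed space of `g ≠ 1`,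
unless `g` is a reflection and the zero locus of the polynomial is its mirror. -/
theorem exists_form_not_dvd {g : V ≃ₗ[ℂ] V} (hg : g ≠ 1) (hfin : IsOfFinOrder g) {p : Coord V}
    (hp : Prime p) {v : V} (hv : evalAt v p = 0) (hgv : IsReflection g → g v ≠ v) :
    ∃ η : Module.Dual ℂ V, (∀ x, g x = x → η x = 0) ∧
      ¬ p ∣ SymmetricAlgebra.ι ℂ (Module.Dual ℂ V) η := by
  by_cases hr : IsReflection g
  · obtain ⟨α, -, hα, -⟩ := exists_ker_eq_of_isCoatom hr.2
    refine ⟨α, fun x hx => ?_, fun hdvd => hgv hr ?_⟩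
    · have : x ∈ fixedSpace g := hx
      rwa [← hα] at this
    · have h0 : α v = 0 := by
        obtain ⟨c, hc⟩ := hdvd
        rw [← evalAt_ι, hc, map_mul, hv, zero_mul]
      have : v ∈ fixedSpace g := hα ▸ h0
      exact this
  have hne : fixedSpace g ≠ ⊤ := fun h => hg (LinearEquiv.ext fun x => by
    have hx : x ∈ fixedSpace g := h ▸ Submodule.mem_top
    exact hx)
  have hco : ¬ IsCoatom (fixedSpace g) := fun h => hr ⟨hfin, h⟩
  obtain ⟨Y, hY, hYt⟩ : ∃ Y, fixedSpace g < Y ∧ Y ≠ ⊤ := by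
    by_contra! h
    exact hco ⟨hne, h⟩
  obtain ⟨x, hxY, hx⟩ := SetLike.exists_of_lt hY
  obtain ⟨β, hβ0, hβ⟩ := Submodule.exists_le_ker_of_lt_top Y (lt_top_iff_ne_top.2 hYt)
  obtain ⟨α, hαx, hα⟩ := Submodule.exists_le_ker_of_notMem hx
  -- The fixed space has codimension at least two, so `α` and `β` are independent; a common prime
  -- divisor would be proportional to both.
  by_contra! hall
  obtain ⟨k, hk⟩ := exists_smul_eq_of_prime_dvd_ι hp (hall α fun y hy => hα hy)
  obtain ⟨l, hl⟩ := exists_smul_eq_of_prime_dvd_ι hp (hall β fun y hy => hβ (hY.le hy))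
  have hlk : l • α = k • β := by
    apply ι_injective
    rw [map_smul, map_smul, hk, hl, smul_comm]
  have hl0 : l = 0 := by
    have := LinearMap.congr_fun hlk x
    rw [LinearMap.smul_apply, LinearMap.smul_apply, show β x = 0 from hβ hxY, smul_zero,
      smul_eq_mul, mul_eq_zero] at this
    exact this.resolve_right hαx
  rw [hl0, zero_smul, map_eq_zero_iff _ ι_injective] at hl
  exact hβ0 hl

/-- Interpolation on `W`: the function `w ↦ ∑ j, (w • e j) * a j` can be made to vanish off `N` and
be nonzero at `x` for `w = 1`, because `N`-invariants tell `x` from its translates by elements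
outside `N`. The denominator `s` costs nothing, as it does not vanish at `x`. -/
theorem exists_coeff_of_stabilizer_le [Finite W] {N : Subgroup W} {n : ℕ} {e : Fin n → Coord V}
    {s : Invariants W}
    (hs : ∀ c ∈ invariantSubmodule W N, s • c ∈ Submodule.span (Invariants W) (Set.range e))
    {x : V} (hx : ∀ w : W, w • x = x → w ∈ N) (hsx : evalAt x (s : Coord V) ≠ 0) :
    ∃ a : Fin n → Coord V, (∀ w ∉ N, ∑ j, (w • e j) * a j = 0) ∧
      evalAt x (∑ j, e j * a j) ≠ 0 := by
  classical
  have := Fintype.ofFinite W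
  have hc : ∀ u : W, u ∉ N → ∃ c ∈ invariantSubmodule W N,
      evalAt x c ≠ evalAt ((u⁻¹ : W) • x) c := by
    refine fun u hu => exists_mem_invariantSubmodule_evalAt_ne fun m hm h => hu ?_
    rw [smul_smul] at h
    have := N.mul_mem (N.inv_mem hm) (hx _ h)
    rw [inv_mul_cancel_left] at this
    exact N.inv_mem_iff.1 this
  choose! c hcN hc using hc
  -- The functions `w ↦ w • c` with `c` an `N`-invariant are closed under products, so `F` below is
  -- in their span over `Coord V`. After multiplication by `s`, each is a combination of the
  -- functions `w ↦ w • e j`.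
  let T : Submonoid (W → Coord V) :=
    { carrier := {F | ∃ c ∈ invariantSubmodule W N, F = fun w => w • c}
      mul_mem' := by
        rintro _ _ ⟨c, hc, rfl⟩ ⟨d, hd, rfl⟩
        exact ⟨c * d, invariantSubmodule_mul_mem hc hd, funext fun w => (smul_mul' w c d).symm⟩
      one_mem' := ⟨1, fun h _ => smul_one h, funext fun w => (smul_one w).symm⟩ }
  let F : W → Coord V := ∏ u ∈ Finset.univ.filter (fun u : W => u ∉ N),
    ((fun w => w • c u) - algebraMap (Coord V) (W → Coord V) (u • c u))
  have hF : F ∈ Submodule.span (Coord V) (T : Set (W → Coord V)) := by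
    rw [← Submonoid.closure_eq T, ← Algebra.adjoin_eq_span, Subalgebra.mem_toSubmodule]
    refine Subalgebra.prod_mem _ fun u hu => sub_mem ?_ (Subalgebra.algebraMap_mem _ _)
    exact Algebra.subset_adjoin ⟨c u, hcN u (Finset.mem_filter.1 hu).2, rfl⟩
  have hFa : ∀ F ∈ Submodule.span (Coord V) (T : Set (W → Coord V)),
      ∃ a : Fin n → Coord V, ∀ w : W, ∑ j, (w • e j) * a j = (s : Coord V) * F w := by
    intro F hF
    induction hF using Submodule.span_induction with
    | mem F hF =>
      obtain ⟨c, hc, rfl⟩ := hF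
      obtain ⟨b, hb⟩ := (Submodule.mem_span_range_iff_exists_fun _).1 (hs c hc)
      refine ⟨fun j => (b j : Coord V), fun w => ?_⟩
      have h1 := congrArg (fun z => w • z) hb
      simp only [Finset.smul_sum] at h1
      calc ∑ j, (w • e j) * (b j : Coord V) = ∑ j, w • (b j • e j) :=
            Finset.sum_congr rfl fun j _ => by
              rw [smul_comm, Subalgebra.smul_def, smul_eq_mul, mul_comm]
        _ = w • s • c := h1
        _ = _ := by rw [smul_comm, Subalgebra.smul_def, smul_eq_mul]
    | zero => exact ⟨0, fun w => by simp⟩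
    | add F G _ _ hF hG =>
      obtain ⟨a, ha⟩ := hF
      obtain ⟨b, hb⟩ := hG
      refine ⟨a + b, fun w => ?_⟩
      simp only [Pi.add_apply, mul_add, Finset.sum_add_distrib, ha, hb]
    | smul r F _ hF =>
      obtain ⟨a, ha⟩ := hF
      refine ⟨r • a, fun w => ?_⟩
      rw [Pi.smul_apply, smul_eq_mul, mul_left_comm, ← ha, Finset.mul_sum]
      exact Finset.sum_congr rfl fun j _ => mul_left_comm _ _ _
  have hFw : ∀ w, F w = ∏ u ∈ Finset.univ.filter (fun u : W => u ∉ N), (w • c u - u • c u) :=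
    fun w => Finset.prod_apply _ _ _
  obtain ⟨a, ha⟩ := hFa F hF
  refine ⟨a, fun w hw => ?_, ?_⟩
  · rw [ha, hFw, Finset.prod_eq_zero (Finset.mem_filter.2 ⟨Finset.mem_univ w, hw⟩) (sub_self _),
      mul_zero]
  · have h1 := ha 1
    simp only [one_smul] at h1
    rw [h1, map_mul, hFw, map_prod]
    refine mul_ne_zero hsx (Finset.prod_ne_zero_iff.2 fun u hu => ?_)
    have h2 := hc u (Finset.mem_filter.1 hu).2
    rw [← evalAt_subgroup_smul] at h2
    rw [one_smul, map_sub]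
    exact sub_ne_zero.2 h2

set_option synthInstance.maxHeartbeats 200000 in
/-- The stabilizer of a point in a reflection group is contained in each subgroup that contains all
the reflections fixing the point. -/
theorem mem_of_smul_eq_of_reflections_mem (hW : IsReflectionGroup W) {N : Subgroup W} {v : V}
    (hN : ∀ r : W, IsReflection (r : V ≃ₗ[ℂ] V) → r • v = v → r ∈ N) {w : W} (hw : w • v = v) :
    w ∈ N := by
  classical
  have := hW.finite
  have := Fintype.ofFinite W
  have := Fintype.ofFinite N
  have := flat_invariants hW
  -- The Reynolds operator makes the `N`-invariants a direct summand of `Coord V`, so they are flat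
  -- and finite over `Invariants W`.
  have hret : (reynolds W N).codRestrict (invariantSubmodule W N) (reynolds_mem W N) ∘ₗ
      (invariantSubmodule W N).subtype = LinearMap.id :=
    LinearMap.ext fun c => Subtype.ext (reynolds_eq_self W c.2)
  have : Module.Flat (Invariants W) (invariantSubmodule W N) := Module.Flat.of_retract _ _ hret
  have : Module.Finite (Invariants W) (invariantSubmodule W N) := Module.Finite.of_surjective
    ((reynolds W N).codRestrict (invariantSubmodule W N) (reynolds_mem W N))
      fun c => ⟨c, LinearMap.congr_fun hret c⟩
  let ev : Invariants W →+* ℂ := (evalAt v : Coord V →+* ℂ).comp (algebraMap _ (Coord V))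
  have : (RingHom.ker ev).IsPrime := RingHom.ker_isPrime ev
  obtain ⟨n, e', s, hsv, hs, he'⟩ :=
    exists_linearIndependent_span_of_flat (M := invariantSubmodule W N) (RingHom.ker ev)
  let e (j : Fin n) : Coord V := e' j
  have hsv : evalAt v (s : Coord V) ≠ 0 := hsv
  have hs : ∀ c ∈ invariantSubmodule W N,
      s • c ∈ Submodule.span (Invariants W) (Set.range e) := by
    intro c hc
    have h := Submodule.mem_map_of_mem (f := (invariantSubmodule W N).subtype) (hs ⟨c, hc⟩)
    rw [Submodule.map_span, ← Set.range_comp] at h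
    exact h
  have he : ∀ c : Fin n → Invariants W, ∑ j, c j • e j = 0 → c = 0 := by
    refine fun c hc => he' c (Subtype.ext ?_)
    rw [AddSubmonoidClass.coe_finsetSum]
    exact hc
  have hs0 : (s : Coord V) ≠ 0 := fun h => hsv (by rw [h, map_zero])
  -- For `a` in `X` the function `w ↦ ∑ j, (w • e j) * a j` is supported on `N`, and is constant
  -- there because the `e j` are `N`-invariant. Call this constant the value of `a`. The aim is an
  -- `a` whose value is nonzero at `v`.
  let X : Set (Fin n → Coord V) := {a | ∀ w ∉ N, ∑ j, (w • e j) * a j = 0}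
  -- elements of `X` are proportional
  have hX : ∀ a ∈ X, ∀ b ∈ X, ∀ j, (∑ i, e i * b i) * a j = (∑ i, e i * a i) * b j := by
    intro a ha b hb j
    refine sub_eq_zero.1 (congrFun (eq_zero_of_forall_sum_smul_mul_eq_zero (W := W) he
      (a := fun j => (∑ i, e i * b i) * a j - (∑ i, e i * a i) * b j) fun w => ?_) j)
    have h1 : ∑ j, (w • e j) * ((∑ i, e i * b i) * a j - (∑ i, e i * a i) * b j) =
        (∑ i, e i * b i) * (∑ j, (w • e j) * a j) - (∑ i, e i * a i) * ∑ j, (w • e j) * b j := by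
      simp only [mul_sub, Finset.sum_sub_distrib]
      rw [Finset.mul_sum, Finset.mul_sum]
      congr 1 <;> exact Finset.sum_congr rfl fun j _ => mul_left_comm _ _ _
    rw [h1]
    by_cases hwN : w ∈ N
    · have h2 : ∀ j, w • e j = e j := fun j => (e' j).2 w hwN
      simp only [h2]
      ring
    · rw [ha w hwN, hb w hwN, mul_zero, mul_zero, sub_zero]
  -- an element of `X` whose value is minimal for divisibility
  let D : Set (Coord V) := {d | d ≠ 0 ∧ ∃ a ∈ X, ∑ i, e i * a i = d}
  have hD : D.Nonempty := by
    obtain ⟨x, hx0, hx⟩ := exists_evalAt_ne_zero_and_smul_ne (W := W) hs0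
    obtain ⟨a, ha, hax⟩ := exists_coeff_of_stabilizer_le hs (x := x) (fun w hw => by
      by_contra hwN
      exact hx w (fun h => hwN (h ▸ N.one_mem)) hw) hx0
    exact ⟨_, fun h => hax (by rw [h, map_zero]), a, ha, rfl⟩
  obtain ⟨d, ⟨hd0, a, haX, had⟩, hmin⟩ :=
    WellFounded.has_min (IsWellFounded.wf : WellFounded (DvdNotUnit (α := Coord V))) D hD
  have hdv : evalAt v d ≠ 0 := by
    intro hdv
    obtain ⟨p, hp, hpd, hpv⟩ := exists_prime_dvd_evalAt_eq_zero hd0 hdv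
    -- Otherwise `a / p` would be in `X`, with value `d / p`, against minimality.
    obtain ⟨j, hj⟩ : ∃ j, ¬ p ∣ a j := by
      by_contra! hall
      choose b hb using hall
      have hpb : p * ∑ i, e i * b i = d := by
        rw [← had, Finset.mul_sum]
        exact Finset.sum_congr rfl fun i _ => by rw [hb i]; ring
      have hb0 : ∑ i, e i * b i ≠ 0 := fun h => hd0 (by rw [← hpb, h, mul_zero])
      refine hmin _ ⟨hb0, b, fun w hw => mul_left_cancel₀ hp.ne_zero ?_, rfl⟩
        ⟨hb0, p, hp.not_isUnit, by rw [mul_comm, hpb]⟩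
      rw [mul_zero, Finset.mul_sum, ← haX w hw]
      exact Finset.sum_congr rfl fun i _ => by rw [hb i]; ring
    -- By proportionality the value of `b` times `a j` is `d * b j`, which `p` divides, while `p`
    -- does not divide `a j`.
    have hdvd : ∀ b ∈ X, p ∣ ∑ i, e i * b i := fun b hb =>
      (hp.dvd_or_dvd (by rw [hX a haX b hb j, had]; exact hpd.mul_right _)).resolve_right hj
    -- No fixed space of an element outside `N` contains the hypersurface `p = 0`: such an element
    -- would be a reflection fixing `v`. A generic point `x` of the hypersurface thus has stabilizer
    -- inside `N` and `s(x) ≠ 0`, so some `b` in `X` has value nonzero at `x`, contrary to `hdvd`.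
    have hη : ∀ w : W, w ∉ N → ∃ η : Module.Dual ℂ V, (∀ x, w • x = x → η x = 0) ∧
        ¬ p ∣ SymmetricAlgebra.ι ℂ (Module.Dual ℂ V) η := fun w hwN =>
      exists_form_not_dvd (g := (w : V ≃ₗ[ℂ] V))
        (fun h => hwN ((Subtype.ext h : w = 1) ▸ N.one_mem))
        ((Subgroup.subtype W).isOfFinOrder (isOfFinOrder_of_finite w)) hp hpv
        (fun hr hwv => hwN (hN w hr hwv))
    choose! η hη hpη using hη
    have hndvd : ¬ p ∣ (s : Coord V) * ∏ w ∈ Finset.univ.filter (fun w : W => w ∉ N),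
        SymmetricAlgebra.ι ℂ (Module.Dual ℂ V) (η w) := by
      intro h
      rcases hp.dvd_or_dvd h with h | h
      · obtain ⟨c, hc⟩ := h
        exact hsv (by rw [hc, map_mul, hpv, zero_mul])
      · obtain ⟨w, hw, hpw⟩ := (hp.dvd_finsetProd_iff _).1 h
        exact hpη w (Finset.mem_filter.1 hw).2 hpw
    obtain ⟨x, hpx, hx⟩ : ∃ x, evalAt x p = 0 ∧ evalAt x ((s : Coord V) *
        ∏ w ∈ Finset.univ.filter (fun w : W => w ∉ N),
          SymmetricAlgebra.ι ℂ (Module.Dual ℂ V) (η w)) ≠ 0 := by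
      by_contra! h
      exact hndvd (dvd_of_evalAt_eq_zero hp h)
    rw [map_mul, mul_ne_zero_iff, map_prod, Finset.prod_ne_zero_iff] at hx
    obtain ⟨b, hb, hbx⟩ := exists_coeff_of_stabilizer_le hs (x := x) (fun w hw => by
      by_contra hwN
      refine hx.2 w (Finset.mem_filter.2 ⟨Finset.mem_univ w, hwN⟩) ?_
      rw [evalAt_ι]
      exact hη w hwN x hw) hx.1
    obtain ⟨c, hc⟩ := hdvd b hb
    exact hbx (by rw [hc, map_mul, hpx, zero_mul])
  -- If `w` fixes `v`, then `w⁻¹ • e j` and `e j` agree at `v`; so the sum for `w⁻¹ ∉ N`, which is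
  -- zero, has value `d(v)` at `v`.
  by_contra hwN
  apply hdv
  rw [← had, ← map_zero (evalAt v), ← haX w⁻¹ (fun h => hwN (N.inv_mem_iff.1 h)), map_sum, map_sum]
  refine Finset.sum_congr rfl fun j _ => ?_
  rw [map_mul, map_mul, evalAt_subgroup_smul, inv_inv, hw]

end Stabilizers

/-! ### The fibre of the quotient map through a point -/

section Fibre

variable {V : Type} [AddCommGroup V] [Module ℂ V] {W : Subgroup (V ≃ₗ[ℂ] V)}

variable (W) in
/-- The ideal of the fibre of `V → V/W` through the point `v`. -/
def fibreIdeal (v : V) : Ideal (Coord V) :=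
  Ideal.span {a | a ∈ Invariants W ∧ evalAt v a = 0}

theorem smul_mem_fibreIdeal (w : W) {v : V} {a : Coord V} (ha : a ∈ fibreIdeal W v) :
    w • a ∈ fibreIdeal W v := by
  induction ha using Submodule.span_induction with
  | mem x hx => rw [hx.1 w]; exact Submodule.subset_span hx
  | zero => rw [smul_zero]; exact zero_mem _
  | add x y _ _ hx hy => rw [smul_add]; exact add_mem hx hy
  | smul r x _ hx => rw [smul_eq_mul, smul_mul']; exact Ideal.mul_mem_left _ _ hx

theorem sum_smul_mem_invariants [Fintype W] (a : Coord V) : ∑ w : W, w • a ∈ Invariants W := by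
  intro u
  rw [Finset.smul_sum]
  refine Fintype.sum_equiv (Equiv.mulLeft u) _ _ fun x => ?_
  rw [smul_smul]
  rfl

theorem mem_of_natCast_mul_mem {I : Ideal (Coord V)} {n : ℕ} (hn : n ≠ 0) {a : Coord V}
    (h : (n : Coord V) * a ∈ I) : a ∈ I := by
  have := I.mul_mem_left (algebraMap ℂ (Coord V) (n : ℂ)⁻¹) h
  rwa [← mul_assoc, ← map_natCast (algebraMap ℂ (Coord V)), ← map_mul,
    inv_mul_cancel₀ (Nat.cast_ne_zero.2 hn), map_one, one_mul] at this

/-- The characteristic polynomial `∏ w, (T - w • a)` has invariant coefficients and annihilates `a`.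
At `v` it specializes to a pure power of `T`, so its lower coefficients are in the fibre ideal. -/
theorem pow_card_mem_fibreIdeal [Fintype W] {v : V} {a : Coord V}
    (ha : ∀ w : W, evalAt (w • v) a = 0) : a ^ Fintype.card W ∈ fibreIdeal W v := by
  let f := MulSemiringAction.charpoly W a
  have hdeg : f.natDegree = Fintype.card W := by
    rw [show f = ∏ w : W, (Polynomial.X - Polynomial.C (w • a)) from rfl,
      Polynomial.natDegree_prod_of_monic _ _ fun w _ => Polynomial.monic_X_sub_C _]
    simp
  have hmap : f.map (evalAt v : Coord V →+* ℂ) = Polynomial.X ^ Fintype.card W := by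
    rw [show f = ∏ w : W, (Polynomial.X - Polynomial.C (w • a)) from rfl, Polynomial.map_prod,
      Finset.prod_congr rfl (g := fun _ => Polynomial.X) fun w _ => ?_, Finset.prod_const,
      Finset.card_univ]
    rw [Polynomial.map_sub, Polynomial.map_X, Polynomial.map_C, RingHom.coe_coe,
      evalAt_subgroup_smul, ha, map_zero, sub_zero]
  have heval := MulSemiringAction.eval_charpoly W a
  rw [Polynomial.eval_eq_sum_range, hdeg, Finset.sum_range_succ, ← hdeg,
    (MulSemiringAction.monic_charpoly W a).coeff_natDegree, one_mul, hdeg] at heval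
  rw [eq_neg_of_add_eq_zero_right heval]
  refine neg_mem (Submodule.sum_mem _ fun i hi => Ideal.mul_mem_right _ _
    (Ideal.subset_span ⟨fun w => MulSemiringAction.smul_coeff_charpoly a i w, ?_⟩))
  have := congrArg (fun q => Polynomial.coeff q i) hmap
  simp only [Polynomial.coeff_map, Polynomial.coeff_X_pow] at this
  rw [if_neg (Finset.mem_range.1 hi).ne] at this
  exact this

/-- A function that is, modulo the ideal of the fibre, an idempotent concentrated at the point. -/
theorem exists_localizing [FiniteDimensional ℂ V] [Fintype W] {v : V} {H : Subgroup W}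
    (hH : ∀ w, w ∈ H ↔ w • v = v) :
    ∃ p : Coord V, (∀ h ∈ H, h • p = p) ∧ evalAt v p = 1 ∧
      (∀ w : W, w ∉ H → evalAt (w • v) p = 0) ∧
      ∀ u : W, u ∉ H → p * u • p ∈ fibreIdeal W v := by
  have := Fintype.ofFinite H
  obtain ⟨a, ha1, ha⟩ := exists_evalAt_orbit (W := W) v
  let q := ∏ h : H, (h : W) • a
  have hq : ∀ h ∈ H, h • q = q := by
    intro h hh
    rw [Finset.smul_prod']
    refine Fintype.prod_equiv (Equiv.mulLeft (⟨h, hh⟩ : H)) _ _ fun x => ?_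
    rw [smul_smul]
    rfl
  have hq1 : evalAt v q = 1 := by
    rw [map_prod]
    refine Finset.prod_eq_one fun h _ => ?_
    rw [evalAt_subgroup_smul, (hH _).1 (H.inv_mem h.2), ha1]
  have hq0 : ∀ w : W, w ∉ H → evalAt (w • v) q = 0 := by
    intro w hw
    rw [map_prod]
    refine Finset.prod_eq_zero (Finset.mem_univ (1 : H)) ?_
    rw [OneMemClass.coe_one, one_smul]
    exact ha w fun h => hw ((hH w).2 h)
  -- For `u ∉ H` the product `q * u • q` vanishes on the whole orbit of `v`; the exponent is the one
  -- from `pow_card_mem_fibreIdeal`.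
  refine ⟨q ^ Fintype.card W, fun h hh => by rw [smul_pow', hq h hh],
    by rw [map_pow, hq1, one_pow],
    fun w hw => by rw [map_pow, hq0 w hw, zero_pow Fintype.card_ne_zero], fun u hu => ?_⟩
  rw [smul_pow', ← mul_pow]
  refine pow_card_mem_fibreIdeal fun w => ?_
  rw [map_mul, evalAt_subgroup_smul, smul_smul, mul_eq_zero]
  by_cases hw : w ∈ H
  · exact Or.inr (hq0 _ fun h => hu (by
      have := H.mul_mem hw (H.inv_mem h)
      rwa [mul_inv_rev, inv_inv, mul_inv_cancel_left] at this))
  · exact Or.inl (hq0 w hw)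

variable {v : V} {H : Subgroup W}

/-- An `H`-invariant is a `W`-invariant near `v`: average `f * p` over `W` to get an element of the
fibre ideal, then multiply by `p`. The terms outside `H` die modulo the ideal and those in `H` all
equal `p ^ 2 * f`. -/
theorem mul_mem_fibreIdeal_of_invariant [Fintype W] {p : Coord V} (hp : ∀ h ∈ H, h • p = p)
    (hH : ∀ w, w ∈ H ↔ w • v = v)
    (hp0 : ∀ w : W, w ∉ H → evalAt (w • v) p = 0)
    (hpu : ∀ u : W, u ∉ H → p * u • p ∈ fibreIdeal W v) {f : Coord V}
    (hf : ∀ h ∈ H, h • f = f) (hfv : evalAt v f = 0) : p ^ 2 * f ∈ fibreIdeal W v := by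
  classical
  have hF : ∑ w : W, w • (f * p) ∈ fibreIdeal W v := by
    refine Ideal.subset_span ⟨sum_smul_mem_invariants _, ?_⟩
    rw [map_sum]
    refine Finset.sum_eq_zero fun w _ => ?_
    rw [evalAt_subgroup_smul, map_mul, mul_eq_zero]
    by_cases hw : w⁻¹ ∈ H
    · rw [(hH _).1 hw]
      exact Or.inl hfv
    · exact Or.inr (hp0 _ hw)
  have h1 := Ideal.mul_mem_left _ p hF
  rw [← Finset.sum_filter_add_sum_filter_not _ (fun w : W => w ∈ H), mul_add] at h1
  have h2 : p * ∑ w ∈ Finset.univ.filter (fun w : W => ¬ w ∈ H), w • (f * p) ∈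
      fibreIdeal W v := by
    rw [Finset.mul_sum]
    refine Submodule.sum_mem _ fun w hw => ?_
    rw [smul_mul', mul_left_comm]
    exact Ideal.mul_mem_left _ _ (hpu w (Finset.mem_filter.1 hw).2)
  have h3 := (Submodule.add_mem_iff_left _ h2).1 h1
  rw [Finset.sum_congr rfl (g := fun _ => f * p) fun w hw => by
    rw [smul_mul', hf w (Finset.mem_filter.1 hw).2, hp w (Finset.mem_filter.1 hw).2],
    Finset.sum_const, nsmul_eq_mul, mul_left_comm] at h3
  have h4 := mem_of_natCast_mul_mem (Finset.card_ne_zero.2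
    ⟨1, Finset.mem_filter.2 ⟨Finset.mem_univ _, H.one_mem⟩⟩) h3
  rwa [show p ^ 2 * f = p * (f * p) by ring]

variable (H) in
theorem coinvariantsAut_mk (h : H) (a : Coord V) :
    coinvariantsAut H h (Ideal.Quotient.mk _ a) = Ideal.Quotient.mk _ (h • a) := rfl

/-- The restriction of functions on `V` to `W ×_H (v + Co(H, V))`, for a subgroup `H` of the
stabilizer of `v`. -/
def fibreHom (v : V) (H : Subgroup W) (hv : ∀ h ∈ H, h • v = v) :
    Coord V →ₐ[ℂ] inducedAlgebra (coinvariantsAut H) where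
  toFun a := ⟨fun g => Ideal.Quotient.mk (coinvariantIdeal H) (translate v ((g⁻¹ : W) • a)),
    fun h g => by
      beta_reduce
      rw [coinvariantsAut_mk, mul_inv_rev, inv_inv, mul_smul]
      exact congrArg _ (translate_smul (h : V ≃ₗ[ℂ] V) (hv h h.2) _)⟩
  map_one' := Subtype.ext (funext fun g => by simp)
  map_mul' a b := Subtype.ext (funext fun g => by simp [smul_mul'])
  map_zero' := Subtype.ext (funext fun g => by simp)
  map_add' a b := Subtype.ext (funext fun g => by simp [smul_add])
  commutes' c := Subtype.ext (funext fun g => by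
    have : (g⁻¹ : W) • algebraMap ℂ (Coord V) c = algebraMap ℂ (Coord V) c :=
      (coordHom _).commutes c
    change Ideal.Quotient.mk (coinvariantIdeal H) (translate v ((g⁻¹ : W) • _)) = _
    rw [this, AlgHom.commutes]
    rfl)

theorem fibreHom_apply (hv : ∀ h ∈ H, h • v = v) (a : Coord V) (g : W) :
    (fibreHom v H hv a).1 g =
      Ideal.Quotient.mk (coinvariantIdeal H) (translate v ((g⁻¹ : W) • a)) := rfl

theorem inducedAut_fibreHom (hv : ∀ h ∈ H, h • v = v) (w : W) (a : Coord V) :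
    inducedAut (coinvariantsAut H) w (fibreHom v H hv a) = fibreHom v H hv (w • a) := by
  refine Subtype.ext (funext fun g => ?_)
  change (fibreHom v H hv a).1 (w⁻¹ * g) = _
  rw [fibreHom_apply, fibreHom_apply, mul_inv_rev, inv_inv, mul_smul]

theorem coinvariantsPoint_fibreHom (hv : ∀ h ∈ H, h • v = v) (a : Coord V) :
    coinvariantsPoint H ((fibreHom v H hv a).1 1) = evalAt v a := by
  rw [fibreHom_apply, inv_one, one_smul]
  change evalZero V (translate v a) = _
  rw [← evalAt_zero, evalAt_translate, zero_add]

theorem translate_mem_coinvariantIdeal (hv : ∀ h ∈ H, h • v = v) {a : Coord V}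
    (ha : ∀ h ∈ H, h • a = a) (hav : evalAt v a = 0) : translate v a ∈ coinvariantIdeal H := by
  refine Ideal.subset_span ⟨fun h => ?_, ?_⟩
  · exact (translate_smul ((h : W) : V ≃ₗ[ℂ] V) (hv h h.2) a).symm.trans
      (congrArg _ (ha h h.2))
  · rw [← evalAt_zero, evalAt_translate, zero_add, hav]

theorem fibreHom_eq_zero_of_mem (hv : ∀ h ∈ H, h • v = v) {a : Coord V}
    (ha : a ∈ fibreIdeal W v) : fibreHom v H hv a = 0 := by
  suffices h : fibreIdeal W v ≤ RingHom.ker (fibreHom v H hv) from h ha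
  refine Ideal.span_le.2 fun b hb => ?_
  refine Subtype.ext (funext fun g => ?_)
  rw [fibreHom_apply, hb.1 g⁻¹]
  exact Ideal.Quotient.eq_zero_iff_mem.2
    (translate_mem_coinvariantIdeal hv (fun h _ => hb.1 h) hb.2)

theorem translate_neg_smul {g : V ≃ₗ[ℂ] V} (hv : g v = v) (a : Coord V) :
    g • translate (-v) a = translate (-v) (g • a) :=
  (translate_smul g (by rw [map_neg, hv]) a).symm

/-- The kernel of the restriction of functions to `W ×_H (v + Co(H, V))`, for the stabilizer `H` of
`v`, is the ideal of the fibre through `v`. -/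
theorem mem_fibreIdeal_of_fibreHom_eq_zero [FiniteDimensional ℂ V] [Finite W]
    (hH : ∀ w, w ∈ H ↔ w • v = v)
    {a : Coord V} (ha : fibreHom v H (fun h => (hH h).1) a = 0) : a ∈ fibreIdeal W v := by
  classical
  have := Fintype.ofFinite W
  obtain ⟨p, hp, hp1, hp0, hpu⟩ := exists_localizing hH
  -- Multiplication by `p ^ 2` carries the coinvariant ideal, translated to `v`, into the fibre
  -- ideal.
  have hCI : ∀ b ∈ coinvariantIdeal H, p ^ 2 * translate (-v) b ∈ fibreIdeal W v := by
    intro b hb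
    induction hb using Submodule.span_induction with
    | mem b hb =>
      refine mul_mem_fibreIdeal_of_invariant hp hH hp0 hpu (fun h hh => ?_) ?_
      · refine (translate_neg_smul ((hH h).1 hh) b).trans ?_
        exact congrArg _ (hb.1 ⟨h, hh⟩)
      · rw [evalAt_translate, add_neg_cancel, evalAt_zero]
        exact hb.2
    | zero => rw [map_zero, mul_zero]; exact zero_mem _
    | add x y _ _ hx hy => rw [map_add, mul_add]; exact add_mem hx hy
    | smul r x _ hx =>
      rw [smul_eq_mul, map_mul, mul_left_comm]
      exact Ideal.mul_mem_left _ _ hx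
  have h1 : ∀ g : W, (g • p) ^ 2 * a ∈ fibreIdeal W v := by
    intro g
    have h2 : translate v ((g⁻¹ : W) • a) ∈ coinvariantIdeal H :=
      Ideal.Quotient.eq_zero_iff_mem.1 (congrFun (congrArg Subtype.val ha) g)
    have h3 := smul_mem_fibreIdeal g (hCI _ h2)
    rwa [translate_add, neg_add_cancel, translate_zero, smul_mul', smul_pow', smul_inv_smul] at h3
  -- The sum of the `g • p ^ 2` is invariant with value `n` at `v`, so modulo the fibre ideal it is
  -- the nonzero constant `n`.
  have h4 : (∑ g : W, g • p ^ 2) * a ∈ fibreIdeal W v := by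
    rw [Finset.sum_mul]
    exact Submodule.sum_mem _ fun g _ => by rw [smul_pow']; exact h1 g
  let n := (Finset.univ.filter fun g : W => g⁻¹ ∈ H).card
  have hn : n ≠ 0 := Finset.card_ne_zero.2
    ⟨1, Finset.mem_filter.2 ⟨Finset.mem_univ _, by rw [inv_one]; exact H.one_mem⟩⟩
  have h5 : (∑ g : W, g • p ^ 2) - (n : Coord V) ∈ fibreIdeal W v := by
    refine Ideal.subset_span ⟨sub_mem (sum_smul_mem_invariants _) (natCast_mem _ n), ?_⟩
    rw [map_sub, map_natCast, map_sum, show n = _ from Finset.card_filter _ _, Nat.cast_sum,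
      sub_eq_zero]
    refine Finset.sum_congr rfl fun g _ => ?_
    rw [evalAt_subgroup_smul, map_pow]
    split_ifs with h
    · rw [(hH _).1 h, hp1, one_pow, Nat.cast_one]
    · rw [hp0 _ h, zero_pow two_ne_zero, Nat.cast_zero]
  refine mem_of_natCast_mul_mem hn ?_
  have h6 := sub_mem h4 (Ideal.mul_mem_right a _ h5)
  rwa [sub_mul, sub_sub_cancel] at h6

theorem fibreHom_surjective [FiniteDimensional ℂ V] [Finite W] (hH : ∀ w, w ∈ H ↔ w • v = v) :
    Function.Surjective (fibreHom v H (fun h => (hH h).1)) := by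
  classical
  have := Fintype.ofFinite W
  obtain ⟨p, hp, hp1, hp0, hpu⟩ := exists_localizing hH
  let m : Coord V →+* Coinvariants H :=
    (Ideal.Quotient.mk (coinvariantIdeal H)).comp (translate v : Coord V →+* Coord V)
  have hmp : m p = 1 := by
    rw [← map_one m]
    refine Ideal.Quotient.eq.2 ?_
    rw [RingHom.coe_coe, ← map_sub]
    refine translate_mem_coinvariantIdeal (fun h => (hH h).1) (fun h hh => ?_) ?_
    · rw [smul_sub, hp h hh, smul_one]
    · rw [map_sub, hp1, map_one, sub_self]
  have hmu : ∀ u : W, u ∉ H → m (u • p) = 0 := by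
    intro u hu
    have h1 := congrFun (congrArg Subtype.val
      (fibreHom_eq_zero_of_mem (fun h => (hH h).1) (hpu u hu))) 1
    rw [fibreHom_apply, inv_one, one_smul] at h1
    have h2 : m (p * u • p) = 0 := h1
    rwa [map_mul, hmp, one_mul] at h2
  rintro ⟨F, hF⟩
  have hsurj : ∀ x : Coinvariants H, ∃ a, m a = x := by
    intro x
    obtain ⟨a, rfl⟩ := Ideal.Quotient.mk_surjective x
    refine ⟨translate (-v) a, ?_⟩
    change Ideal.Quotient.mk _ (translate v (translate (-v) a)) = _
    rw [translate_add, add_neg_cancel, translate_zero]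
  choose a ha using fun g => hsurj (F g)
  let n := (Finset.univ.filter fun g : W => g ∈ H).card
  have hn : (n : ℂ) ≠ 0 := Nat.cast_ne_zero.2 (Finset.card_ne_zero.2
    ⟨1, Finset.mem_filter.2 ⟨Finset.mem_univ _, H.one_mem⟩⟩)
  -- Here `a g` lifts `F g` and `g • p` localizes to the coset of `g`. At `k` only the terms `g = k
  -- * u` with `u ∈ H` survive; by equivariance of `F` each contributes `F k`, and there are `n` of
  -- them.
  refine ⟨(n : ℂ)⁻¹ • ∑ g : W, (g • p) * g • a g, ?_⟩
  rw [map_smul, inv_smul_eq_iff₀ hn]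
  refine Subtype.ext (funext fun k => ?_)
  change m ((k⁻¹ : W) • ∑ g : W, (g • p) * g • a g) = (n : ℂ) • F k
  rw [Finset.smul_sum, map_sum, Nat.cast_smul_eq_nsmul ℂ, ← Finset.sum_const, Finset.sum_filter]
  refine (Fintype.sum_equiv (Equiv.mulLeft k) _ _ fun u => ?_).symm
  rw [Equiv.coe_mulLeft, smul_mul', smul_smul, smul_smul, inv_mul_cancel_left, map_mul]
  split_ifs with hu
  · rw [hp u hu, hmp, one_mul]
    have h1 := hF ⟨u, hu⟩ (k * u)
    rw [mul_inv_cancel_right] at h1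
    rw [h1, ← ha (k * u)]
    change Ideal.Quotient.mk _ (u • translate v (a (k * u))) = _
    exact congrArg _ (translate_smul (u : V ≃ₗ[ℂ] V) ((hH u).1 hu) _).symm
  · rw [hmu u hu, zero_mul]

end Fibre

/-! ### Parabolic subgroups and points -/

section Parabolic

variable {V : Type} [AddCommGroup V] [Module ℂ V] {W : Subgroup (V ≃ₗ[ℂ] V)}

theorem mem_pointwiseStabilizer {X : Submodule ℂ V} {w : W} :
    w ∈ pointwiseStabilizer W X ↔ ∀ x ∈ X, w • x = x := by
  rw [pointwiseStabilizer, mem_fixingSubgroup_iff]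
  rfl

theorem mem_pointwiseStabilizer_iff_le {X : Submodule ℂ V} {w : W} :
    w ∈ pointwiseStabilizer W X ↔ X ≤ fixedSpace (w : V ≃ₗ[ℂ] V) :=
  mem_pointwiseStabilizer

/-- The mirrors cutting out `Y` belong to reflections in `W_Y`; these fix `X`, so the mirrors
contain `X`. -/
theorem le_of_pointwiseStabilizer_le {X Y : Submodule ℂ V} (hY : Y ∈ intersections W)
    (h : pointwiseStabilizer W Y ≤ pointwiseStabilizer W X) : X ≤ Y := by
  obtain ⟨B, hB, rfl⟩ := hY
  refine le_sInf fun a ha => ?_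
  obtain ⟨r, hr, -, rfl⟩ := hB ha
  have : (⟨r, hr⟩ : W) ∈ pointwiseStabilizer W (sInf B) :=
    mem_pointwiseStabilizer_iff_le.2 (sInf_le ha)
  exact mem_pointwiseStabilizer_iff_le.1 (h this)

theorem intersections_ext {X Y : intersections W}
    (h : pointwiseStabilizer W X.1 = pointwiseStabilizer W Y.1) : X = Y :=
  Subtype.ext (le_antisymm (le_of_pointwiseStabilizer_le Y.2 h.ge)
    (le_of_pointwiseStabilizer_le X.2 h.le))

theorem mem_pointwiseStabilizer_smul {X : intersections W} {w u : W} :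
    u ∈ pointwiseStabilizer W (w • X).1 ↔ w⁻¹ * u * w ∈ pointwiseStabilizer W X.1 := by
  rw [mem_pointwiseStabilizer, mem_pointwiseStabilizer]
  constructor
  · intro h x hx
    rw [mul_smul, mul_smul, inv_smul_eq_iff]
    exact h _ ⟨x, hx, rfl⟩
  · rintro h _ ⟨x, hx, rfl⟩
    have := h x hx
    rwa [mul_smul, mul_smul, inv_smul_eq_iff] at this

/-- A generic point of an intersection of mirrors. -/
theorem exists_stabilizer_eq_pointwiseStabilizer [Finite W] (X : Submodule ℂ V) :
    ∃ v ∈ X, ∀ w : W, w ∈ pointwiseStabilizer W X ↔ w • v = v := by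
  classical
  have := Fintype.ofFinite W
  -- Fixed spaces of elements outside `W_X` meet `X` in proper subspaces, and finitely many of these
  -- do not cover `X`.
  let S : Finset (Subspace ℂ X) := Finset.image
    (fun w : W => (fixedSpace (w : V ≃ₗ[ℂ] V)).comap X.subtype)
    (Finset.univ.filter fun w : W => w ∉ pointwiseStabilizer W X)
  have hS : ⊤ ∉ S := by
    intro h
    obtain ⟨w, hw, hwt⟩ := Finset.mem_image.1 h
    refine (Finset.mem_filter.1 hw).2 (mem_pointwiseStabilizer_iff_le.2 fun x hx => ?_)
    have : (⟨x, hx⟩ : X) ∈ (fixedSpace (w : V ≃ₗ[ℂ] V)).comap X.subtype := hwt ▸ Submodule.mem_top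
    exact this
  obtain ⟨⟨v, hv⟩, hvS⟩ := (Set.ne_univ_iff_exists_notMem _).1
    (Subspace.biUnion_ne_univ_of_top_notMem hS)
  refine ⟨v, hv, fun w => ⟨fun h => mem_pointwiseStabilizer.1 h v hv, fun h => ?_⟩⟩
  by_contra hw
  refine hvS (Set.mem_iUnion₂.2 ⟨(fixedSpace (w : V ≃ₗ[ℂ] V)).comap X.subtype,
    Finset.mem_image.2 ⟨w, Finset.mem_filter.2 ⟨Finset.mem_univ _, hw⟩, rfl⟩, ?_⟩)
  exact h

/-- The stabilizer of a point in a reflection group is the pointwise stabilizer of an intersection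
of mirrors. -/
theorem exists_intersection_of_point [FiniteDimensional ℂ V] (hW : IsReflectionGroup W) (v : V) :
    ∃ X : intersections W, ∀ w : W, w ∈ pointwiseStabilizer W X.1 ↔ w • v = v := by
  -- `X` is the intersection of the mirrors through `v`. Each reflection fixing `v` fixes `X`, so
  -- Steinberg's theorem applies with `N = W_X`.
  refine ⟨⟨sInf {a | a ∈ mirrors W ∧ v ∈ a}, _, fun a ha => ha.1, rfl⟩, fun w => ⟨fun h => ?_,
    mem_of_smul_eq_of_reflections_mem hW fun r hr hrv => ?_⟩⟩
  · exact mem_pointwiseStabilizer.1 h v (Submodule.mem_sInf.2 fun a ha => ha.2)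
  · exact mem_pointwiseStabilizer_iff_le.2 (sInf_le ⟨⟨r, r.2, hr, rfl⟩, hrv⟩)

/-- Invariant polynomial functions separate the orbits. -/
theorem exists_smul_eq_of_evalAt_eq [FiniteDimensional ℂ V] [Finite W] {x v : V}
    (h : ∀ b : Invariants W, evalAt x (b : Coord V) = evalAt v (b : Coord V)) :
    ∃ w : W, x = w • v := by
  classical
  have := Fintype.ofFinite W
  by_contra! hne
  obtain ⟨a, hax, ha⟩ := exists_evalAt_eq_one_of_notMem
    (Finset.univ.image fun w : W => w • v) (x := x) (by
      rintro hx
      obtain ⟨w, -, hw⟩ := Finset.mem_image.1 hx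
      exact hne w hw.symm)
  -- This invariant is 0 at `x` and 1 at `v`.
  have hinv : ∏ w : W, w • (1 - a) ∈ Invariants W := by
    intro u
    rw [Finset.smul_prod']
    refine Fintype.prod_equiv (Equiv.mulLeft u) _ _ fun x => ?_
    rw [smul_smul]
    rfl
  have h0 := h ⟨_, hinv⟩
  rw [map_prod, map_prod, Finset.prod_eq_zero (Finset.mem_univ (1 : W)),
    Finset.prod_eq_one] at h0
  · exact zero_ne_one h0
  · intro w _
    rw [evalAt_subgroup_smul, map_sub, map_one,
      ha _ (Finset.mem_image.2 ⟨w⁻¹, Finset.mem_univ _, rfl⟩), sub_zero]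
  · rw [one_smul, map_sub, map_one, hax, sub_self]

/-- Each point of `V/W` is the image of a point of `V`. -/
theorem exists_evalAt_eq_on_invariants [FiniteDimensional ℂ V] [Finite W]
    (χ : Invariants W →ₐ[ℂ] ℂ) : ∃ v, ∀ b : Invariants W, χ b = evalAt v (b : Coord V) := by
  have hχ : Function.Surjective χ := fun c => ⟨algebraMap ℂ _ c, χ.commutes c⟩
  have hmax : (RingHom.ker χ).IsMaximal := RingHom.ker_isMaximal_of_surjective χ hχ
  have : Algebra.IsIntegral (Invariants W) (Coord V) :=
    Algebra.IsInvariant.isIntegral (Invariants W) (Coord V) W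
  obtain ⟨Q, hQ, hQχ⟩ := Ideal.exists_ideal_over_maximal_of_isIntegral (S := Coord V)
    (RingHom.ker χ) (by
      rw [(RingHom.injective_iff_ker_eq_bot _).1 Subtype.val_injective]
      exact bot_le)
  let _ : Field (Coord V ⧸ Q) := Ideal.Quotient.field Q
  -- By Zariski's lemma the residue field at a maximal ideal over the kernel of `χ` is finite over
  -- `ℂ`.
  have : Module.Finite ℂ (Coord V ⧸ Q) := finite_of_finite_type_of_isJacobsonRing ℂ (Coord V ⧸ Q)
  have : Algebra.IsAlgebraic ℂ (Coord V ⧸ Q) := Algebra.IsAlgebraic.of_finite ℂ _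
  let ψ : (Coord V ⧸ Q) →ₐ[ℂ] ℂ := IsAlgClosed.lift
  obtain ⟨v, hv⟩ := exists_evalAt_eq (ψ.comp (Ideal.Quotient.mkₐ ℂ Q))
  refine ⟨v, fun b => ?_⟩
  rw [← hv]
  have hb : b - algebraMap ℂ _ (χ b) ∈ RingHom.ker χ := by
    rw [RingHom.mem_ker, map_sub, AlgHom.commutes, Algebra.algebraMap_self_apply, sub_self]
  rw [← hQχ] at hb
  have h1 : Ideal.Quotient.mkₐ ℂ Q ((b : Coord V) - algebraMap ℂ _ (χ b)) = 0 :=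
    Ideal.Quotient.eq_zero_iff_mem.2 hb
  have h2 := congrArg ψ h1
  rw [map_sub, map_sub, AlgHom.commutes, AlgHom.commutes, map_zero, sub_eq_zero] at h2
  exact h2.symm

end Parabolic

/-! ### Equivariant base change -/

section BaseChange

variable {S T : Scheme.{0}} {G : Type} [Group G]

/-- An equivariant cartesian square identifies the base change of a `G`-scheme. -/
theorem exists_iso_of_isPullback {φ : S ⟶ T} {C : Action (Over T) G} {D : Action (Over S) G}
    (f : D.V.left ⟶ C.V.left) (hf : IsPullback f D.V.hom C.V.hom φ)
    (heq : ∀ g, (D.ρ g).left ≫ f = f ≫ (C.ρ g).left) :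
    ∃ e : ((Over.pullback φ).mapAction G).obj C ≅ D,
      e.hom.hom.left ≫ f = pullback.fst C.V.hom φ := by
  let i : pullback C.V.hom φ ≅ D.V.left := hf.isoPullback.symm
  have hi₁ : i.hom ≫ f = pullback.fst C.V.hom φ := hf.isoPullback_inv_fst
  have hi₂ : i.hom ≫ D.V.hom = pullback.snd C.V.hom φ := hf.isoPullback_inv_snd
  let j : (Over.pullback φ).obj C.V ≅ D.V := Over.isoMk i hi₂
  refine ⟨Action.mkIso j fun g => ?_, hi₁⟩
  apply Over.OverMorphism.ext
  refine hf.hom_ext ?_ ?_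
  · change (pullback.lift (pullback.fst _ _ ≫ (C.ρ g).left) (pullback.snd _ _) _ ≫ i.hom) ≫ f =
      (i.hom ≫ (D.ρ g).left) ≫ f
    rw [Category.assoc, hi₁, pullback.lift_fst, Category.assoc, heq, ← Category.assoc, hi₁]
  · change (pullback.lift (pullback.fst _ _ ≫ (C.ρ g).left) (pullback.snd _ _) _ ≫ i.hom) ≫
      D.V.hom =
      (i.hom ≫ (D.ρ g).left) ≫ D.V.hom
    rw [Category.assoc, hi₂, pullback.lift_snd, Category.assoc, Over.w, hi₂]

/-- Base change of `G`-schemes along a composite. -/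
theorem nonempty_iso_pullback_comp {R : Scheme.{0}} (p : R ⟶ S) (φ : S ⟶ T)
    (C : Action (Over T) G) :
    Nonempty (((Over.pullback (p ≫ φ)).mapAction G).obj C ≅
      ((Over.pullback p).mapAction G).obj (((Over.pullback φ).mapAction G).obj C)) :=
  ⟨(Functor.mapActionCongr G (Over.pullbackComp p φ)).app C ≪≫
    (Functor.mapActionComp G (Over.pullback φ) (Over.pullback p)).app C⟩

theorem nonempty_iso_pullback_id (C : Action (Over S) G) :
    Nonempty (((Over.pullback (𝟙 S)).mapAction G).obj C ≅ C) :=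
  ⟨(Functor.mapActionCongr G Over.pullbackId).app C ≪≫ Action.mkIso (Iso.refl _) fun _ =>
    (Category.comp_id _).trans (Category.id_comp _).symm⟩

end BaseChange

/-! ### Fibres over complex points and their sections -/

section Points

/-- A commutative square of rings is a pushout if its horizontal maps are surjective and the kernel
of the lower one is generated by the image of the kernel of the upper one. -/
theorem isPushout_of_ker_le_map {A B K R : Type} [CommRing A] [CommRing B] [CommRing K]
    [CommRing R] {f : B →+* A} {χ : B →+* K} {Θ : A →+* R} {κ : K →+* R}
    (h : Θ.comp f = κ.comp χ) (hΘ : Function.Surjective Θ) (hχ : Function.Surjective χ)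
    (hker : RingHom.ker Θ ≤ (RingHom.ker χ).map f) :
    IsPushout (CommRingCat.ofHom f) (CommRingCat.ofHom χ) (CommRingCat.ofHom Θ)
      (CommRingCat.ofHom κ) := by
  have hcond (s : PushoutCocone (CommRingCat.ofHom f) (CommRingCat.ofHom χ)) (b : B) :
      s.inl.hom (f b) = s.inr.hom (χ b) :=
    RingHom.congr_fun (congrArg CommRingCat.Hom.hom s.condition) b
  have hs (s : PushoutCocone (CommRingCat.ofHom f) (CommRingCat.ofHom χ)) :
      RingHom.ker Θ ≤ RingHom.ker s.inl.hom := by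
    refine hker.trans (Ideal.map_le_iff_le_comap.2 fun b hb => ?_)
    rw [Ideal.mem_comap, RingHom.mem_ker, hcond, hb, map_zero]
  refine ⟨⟨CommRingCat.hom_ext h⟩, ⟨PushoutCocone.IsColimit.mk _ (fun s =>
    CommRingCat.ofHom (Θ.liftOfSurjective hΘ ⟨s.inl.hom, hs s⟩)) (fun s => ?_)
    (fun s => ?_) (fun s m h₁ h₂ => ?_)⟩⟩
  · exact CommRingCat.hom_ext (RingHom.liftOfSurjective_comp _ _ _)
  · refine CommRingCat.hom_ext (RingHom.ext fun c => ?_)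
    obtain ⟨b, rfl⟩ := hχ c
    refine Eq.trans (congrArg (Θ.liftOfSurjective hΘ ⟨s.inl.hom, hs s⟩)
      (RingHom.congr_fun h b).symm) (Eq.trans ?_ (hcond s b))
    exact RingHom.liftOfSurjective_comp_apply Θ hΘ _ (f b)
  · exact CommRingCat.hom_ext (RingHom.eq_liftOfSurjective _ _ _ _ _
      (congrArg CommRingCat.Hom.hom h₁))

/-- A surjective étale scheme over `Spec ℂ` has a section. -/
theorem exists_section_of_etale {U : Scheme.{0}} (u : U ⟶ Spec (.of ℂ)) [Etale u] [Surjective u] :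
    ∃ p : Spec (.of ℂ) ⟶ U, p ≫ u = 𝟙 _ := by
  have : Nonempty U := ⟨(u.surjective (IsLocalRing.closedPoint ℂ)).choose⟩
  -- A nonempty scheme locally of finite type over `ℂ` is Jacobson, so it has a closed point, which
  -- is a `ℂ`-point.
  obtain ⟨x, hx⟩ : ∃ x : U, IsClosed {x} := by
    have : JacobsonSpace U := LocallyOfFiniteType.jacobsonSpace u
    have h := JacobsonSpace.closure_inter_closedPoints (X := U) (Z := Set.univ) isClosed_univ
    rw [Set.univ_inter] at h
    obtain ⟨x, hx⟩ : (closedPoints U).Nonempty := by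
      rw [← closure_nonempty_iff, h]
      exact Set.univ_nonempty
    exact ⟨x, hx⟩
  exact ⟨pointOfClosedPoint u x hx, pointOfClosedPoint_comp u x hx⟩

variable {V : Type} [AddCommGroup V] [Module ℂ V] {W : Subgroup (V ≃ₗ[ℂ] V)}

variable (W) in
/-- The value at `v` of invariant polynomial functions. -/
def evalInvariants (v : V) : Invariants W →ₐ[ℂ] ℂ := (evalAt v).comp (Invariants W).val

variable (W) in
/-- The image in `V/W` of the point `v` of `V`. -/
def quotientPoint (v : V) : Spec (.of ℂ) ⟶ quotientScheme W :=
  Spec.map (CommRingCat.ofHom (evalInvariants W v : Invariants W →+* ℂ))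

theorem quotientPoint_comp (v : V) : quotientPoint W v ≫ quotientToSpec W = 𝟙 _ :=
  (specMap_comp_algebraMap (evalInvariants W v)).trans (Spec.map_id _)

theorem quotientPoint_smul (w : W) (v : V) : quotientPoint W (w • v) = quotientPoint W v := by
  have : evalInvariants W (w • v) = evalInvariants W v :=
    AlgHom.ext fun b => evalAt_invariant_smul w v b
  rw [quotientPoint, this]
  rfl

/-- The fibre over the image of `v` of the tautological cover is the spectrum of the induced
algebra, for `H` the stabilizer of `v`. -/
theorem isPushout_fibreHom [FiniteDimensional ℂ V] [Finite W] {v : V} {H : Subgroup W}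
    (hH : ∀ w, w ∈ H ↔ w • v = v) :
    IsPushout (CommRingCat.ofHom (algebraMap (Invariants W) (Coord V)))
      (CommRingCat.ofHom (evalInvariants W v : Invariants W →+* ℂ))
      (CommRingCat.ofHom (fibreHom v H (fun h => (hH h).1) :
        Coord V →+* inducedAlgebra (coinvariantsAut H)))
      (CommRingCat.ofHom (S := inducedAlgebra (coinvariantsAut H)) (algebraMap ℂ _)) := by
  have hval : ∀ b : Invariants W, fibreHom v H (fun h => (hH h).1) (b : Coord V) =
      algebraMap ℂ _ (evalAt v (b : Coord V)) := by
    intro b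
    refine (sub_eq_zero.1 ((map_sub _ _ _).symm.trans (fibreHom_eq_zero_of_mem _
      (Ideal.subset_span ⟨sub_mem b.2 (Subalgebra.algebraMap_mem _ _), ?_⟩)))).trans
      ((fibreHom v H (fun h => (hH h).1)).commutes _)
    rw [map_sub, AlgHom.commutes, Algebra.algebraMap_self_apply, sub_self]
  refine isPushout_of_ker_le_map (RingHom.ext hval) (fibreHom_surjective hH)
    (fun c => ⟨algebraMap ℂ _ c, (evalInvariants W v).commutes c⟩) fun a ha => ?_
  have hle : fibreIdeal W v ≤ Ideal.map (algebraMap (Invariants W) (Coord V))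
      (RingHom.ker (evalInvariants W v : Invariants W →+* ℂ)) :=
    Ideal.span_le.2 fun b hb => Ideal.mem_map_of_mem (algebraMap (Invariants W) (Coord V))
      (x := ⟨b, hb.1⟩) hb.2
  exact hle (mem_fibreIdeal_of_fibreHom_eq_zero hH ha)

/-- The morphism to `V` from the fibre of the tautological cover. -/
def indCoToSpace (v : V) (X : Submodule ℂ V) (hX : ∀ w ∈ pointwiseStabilizer W X, w • v = v) :
    (indCo W X).V.left ⟶ (tautologicalCover W).V.left :=
  Spec.map (CommRingCat.ofHom (fibreHom v (pointwiseStabilizer W X) hX :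
    Coord V →+* inducedAlgebra (coinvariantsAut (pointwiseStabilizer W X))))

theorem indCoPt_comp_indCoToSpace (v : V) (X : Submodule ℂ V)
    (hX : ∀ w ∈ pointwiseStabilizer W X, w • v = v) :
    (indCoPt W X).left ≫ indCoToSpace v X hX =
      Spec.map (CommRingCat.ofHom (evalAt v : Coord V →+* ℂ)) := by
  refine (Spec.map_comp _ _).symm.trans (congrArg Spec.map (CommRingCat.hom_ext ?_))
  exact RingHom.ext fun a => coinvariantsPoint_fibreHom hX a

theorem ρ_comp_indCoToSpace (v : V) (X : Submodule ℂ V)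
    (hX : ∀ w ∈ pointwiseStabilizer W X, w • v = v) (g : W) :
    ((indCo W X).ρ g).left ≫ indCoToSpace v X hX =
      indCoToSpace v X hX ≫ ((tautologicalCover W).ρ g).left := by
  refine (Spec.map_comp _ _).symm.trans (Eq.trans (congrArg Spec.map (CommRingCat.hom_ext ?_))
    (Spec.map_comp _ _))
  exact RingHom.ext fun a => inducedAut_fibreHom hX g⁻¹ a

/-- The compatibility with the maps to `V` is kept so that sections can be followed as points of
`V`. -/
theorem exists_iso_indCo [FiniteDimensional ℂ V] [Finite W] {v : V} {X : Submodule ℂ V}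
    (hX : ∀ w, w ∈ pointwiseStabilizer W X ↔ w • v = v) :
    ∃ e : ((Over.pullback (quotientPoint W v)).mapAction W).obj (tautologicalCover W) ≅ indCo W X,
      e.hom.hom.left ≫ indCoToSpace v X (fun w => (hX w).1) =
        pullback.fst (tautologicalCover W).V.hom (quotientPoint W v) := by
  exact exists_iso_of_isPullback (indCoToSpace v X fun w => (hX w).1)
    (isPullback_SpecMap_of_isPushout _ _ _ _ (isPushout_fibreHom hX))
    (ρ_comp_indCoToSpace v X _)

/-- The fibre is closed in `V`, so its sections are determined by the points of `V` they define. -/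
theorem mono_indCoToSpace [FiniteDimensional ℂ V] [Finite W] {v : V} {X : Submodule ℂ V}
    (hX : ∀ w, w ∈ pointwiseStabilizer W X ↔ w • v = v) :
    Mono (indCoToSpace v X (fun w => (hX w).1)) := by
  have : IsClosedImmersion (indCoToSpace v X (fun w => (hX w).1)) :=
    IsClosedImmersion.spec_of_surjective _ (fibreHom_surjective hX)
  infer_instance

/-- A generic point of `X` has stabilizer `W_X`, so this is a fibre of `V → V/W`; the identity of
`Spec ℂ` serves as étale cover. -/
theorem isCameralCover_indCo [FiniteDimensional ℂ V] [Finite W] (X : Submodule ℂ V) :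
    IsCameralCover W (𝟙 (Spec (.of ℂ))) (indCo W X) := by
  obtain ⟨v, -, hv⟩ := exists_stabilizer_eq_pointwiseStabilizer (W := W) X
  obtain ⟨e, -⟩ := exists_iso_indCo hv
  obtain ⟨i⟩ := nonempty_iso_pullback_id (indCo W X)
  refine ⟨Spec (.of ℂ), 𝟙 _, quotientPoint W v, inferInstance, inferInstance, ?_, ⟨e ≪≫ i.symm⟩⟩
  rw [quotientPoint_comp, Category.comp_id]

/-- The étale cover has a section `p`; pulling the local isomorphism back along `p` gives the fibre
over the `ℂ`-point `p ≫ φ`. -/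
theorem exists_iso_pullback_of_isCameralCover {C : Action (Over (Spec (.of ℂ))) W}
    (hC : IsCameralCover W (𝟙 (Spec (.of ℂ))) C) :
    ∃ χ : Invariants W →ₐ[ℂ] ℂ, Nonempty (((Over.pullback (Spec.map (CommRingCat.ofHom
      (χ : Invariants W →+* ℂ)))).mapAction W).obj (tautologicalCover W) ≅ C) := by
  obtain ⟨U, u, φ, hu, hu', hφ, ⟨e⟩⟩ := hC
  obtain ⟨p, hp⟩ := exists_section_of_etale u
  have hq : (p ≫ φ) ≫ quotientToSpec W = 𝟙 _ := by
    rw [Category.assoc, hφ, Category.comp_id, hp]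
  obtain ⟨q, hqq⟩ : ∃ q : CommRingCat.of (Invariants W) ⟶ CommRingCat.of ℂ,
      Spec.map q = p ≫ φ := ⟨Spec.preimage _, Spec.map_preimage _⟩
  have hq' : CommRingCat.ofHom (algebraMap ℂ (Invariants W)) ≫ q = 𝟙 _ := by
    apply Spec.map_injective
    rw [Spec.map_comp, Spec.map_id, hqq]
    exact hq
  let χ : Invariants W →ₐ[ℂ] ℂ :=
    { q.hom with
      commutes' := fun c => RingHom.congr_fun (congrArg CommRingCat.Hom.hom hq') c }
  refine ⟨χ, ?_⟩
  have hχ : Spec.map (CommRingCat.ofHom (χ : Invariants W →+* ℂ)) = p ≫ φ := hqq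
  rw [hχ]
  obtain ⟨i₁⟩ := nonempty_iso_pullback_comp p φ (tautologicalCover W)
  obtain ⟨i₂⟩ := nonempty_iso_pullback_comp p u C
  rw [hp] at i₂
  obtain ⟨i₃⟩ := nonempty_iso_pullback_id C
  exact ⟨i₁ ≪≫ ((Over.pullback p).mapAction W).mapIso e ≪≫ i₂.symm ≪≫ i₃⟩

end Points

/-! ### Classification of cameral covers of a point -/

section Classification

variable {V : Type} [AddCommGroup V] [Module ℂ V] {W : Subgroup (V ≃ₗ[ℂ] V)}

theorem exists_point_of_section [FiniteDimensional ℂ V] {χ : Invariants W →ₐ[ℂ] ℂ}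
    (σ : Over.mk (𝟙 (Spec (.of ℂ))) ⟶ (((Over.pullback (Spec.map (CommRingCat.ofHom
      (χ : Invariants W →+* ℂ)))).mapAction W).obj (tautologicalCover W)).V) :
    ∃ v, χ = evalInvariants W v ∧
      σ.left ≫ pullback.fst (tautologicalCover W).V.hom
          (Spec.map (CommRingCat.ofHom (χ : Invariants W →+* ℂ))) =
        Spec.map (CommRingCat.ofHom (evalAt v : Coord V →+* ℂ)) := by
  obtain ⟨ψ, hψ⟩ : ∃ ψ : CommRingCat.of (Coord V) ⟶ CommRingCat.of ℂ, Spec.map ψ =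
      σ.left ≫ pullback.fst (tautologicalCover W).V.hom
        (Spec.map (CommRingCat.ofHom (χ : Invariants W →+* ℂ))) :=
    ⟨Spec.preimage _, Spec.map_preimage _⟩
  have h1 : CommRingCat.ofHom (algebraMap (Invariants W) (Coord V)) ≫ ψ =
      CommRingCat.ofHom (χ : Invariants W →+* ℂ) := by
    apply Spec.map_injective
    have h2 : σ.left ≫ pullback.snd (tautologicalCover W).V.hom
        (Spec.map (CommRingCat.ofHom (χ : Invariants W →+* ℂ))) = 𝟙 _ := Over.w σ
    refine (Spec.map_comp _ _).trans ((congrArg (· ≫ _) hψ).trans ((Category.assoc _ _ _).trans ?_))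
    refine (congrArg (σ.left ≫ ·) pullback.condition).trans ((Category.assoc _ _ _).symm.trans ?_)
    exact (congrArg (· ≫ _) h2).trans (Category.id_comp _)
  have h3 : ∀ b : Invariants W, ψ.hom (b : Coord V) = χ b := fun b =>
    RingHom.congr_fun (congrArg CommRingCat.Hom.hom h1) b
  obtain ⟨v, hv⟩ := exists_evalAt_eq
    ({ ψ.hom with commutes' := fun c => (h3 (algebraMap ℂ _ c)).trans (χ.commutes c) } :
      Coord V →ₐ[ℂ] ℂ)
  have h4 : ∀ a, ψ.hom a = evalAt v a := fun a => DFunLike.congr_fun hv a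
  refine ⟨v, AlgHom.ext fun b => (h3 b).symm.trans (h4 b), hψ.symm.trans (congrArg Spec.map ?_)⟩
  exact CommRingCat.hom_ext (RingHom.ext h4)

theorem indCoPt_comp_eq [FiniteDimensional ℂ V] [Finite W] {v : V} {X : Submodule ℂ V}
    (hX : ∀ w, w ∈ pointwiseStabilizer W X ↔ w • v = v)
    {σ τ : Over.mk (𝟙 (Spec (.of ℂ))) ⟶ (indCo W X).V}
    (h : σ.left ≫ indCoToSpace v X (fun w => (hX w).1) =
      τ.left ≫ indCoToSpace v X (fun w => (hX w).1)) : σ = τ := by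
  have := mono_indCoToSpace hX
  exact Over.OverMorphism.ext ((cancel_mono _).1 h)

/-- A pointed cameral cover of `Spec ℂ` is an induced fibre with its distinguished point. -/
theorem exists_iso_indCo_of_section [FiniteDimensional ℂ V] (hW : IsReflectionGroup W)
    {C : Action (Over (Spec (.of ℂ))) W} (hC : IsCameralCover W (𝟙 (Spec (.of ℂ))) C)
    (σ : Over.mk (𝟙 (Spec (.of ℂ))) ⟶ C.V) :
    ∃ X : intersections W, ∃ e : C ≅ indCo W X.1, σ ≫ e.hom.hom = indCoPt W X.1 := by
  have := hW.finite
  obtain ⟨χ, ⟨i⟩⟩ := exists_iso_pullback_of_isCameralCover hC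
  obtain ⟨v, rfl, hv⟩ := exists_point_of_section (σ ≫ i.inv.hom)
  -- Taking for `v` the point that the section defines makes the isomorphism carry `σ` to the
  -- distinguished point.
  obtain ⟨X, hX⟩ := exists_intersection_of_point hW v
  obtain ⟨j, hj⟩ := exists_iso_indCo hX
  refine ⟨X, i.symm ≪≫ j, indCoPt_comp_eq hX ?_⟩
  rw [indCoPt_comp_indCoToSpace, ← hv]
  refine Eq.trans ?_ (congrArg ((σ ≫ i.inv.hom).left ≫ ·) hj)
  simp only [Over.comp_left, Category.assoc]
  rfl

/-- No section is given here; the point `v` over `χ` comes from integrality of `Coord V` over the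
invariants. -/
theorem exists_iso_indCo_of_isCameralCover [FiniteDimensional ℂ V] (hW : IsReflectionGroup W)
    {C : Action (Over (Spec (.of ℂ))) W} (hC : IsCameralCover W (𝟙 (Spec (.of ℂ))) C) :
    ∃ X : intersections W, Nonempty (C ≅ indCo W X.1) := by
  have := hW.finite
  obtain ⟨χ, ⟨i⟩⟩ := exists_iso_pullback_of_isCameralCover hC
  obtain ⟨v, hv⟩ := exists_evalAt_eq_on_invariants χ
  obtain rfl : χ = evalInvariants W v := AlgHom.ext hv
  obtain ⟨X, hX⟩ := exists_intersection_of_point hW v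
  obtain ⟨j, -⟩ := exists_iso_indCo hX
  exact ⟨X, ⟨i.symm ≪≫ j⟩⟩

theorem indCoPt_comp_ρ_comp_indCoToSpace (v : V) (X : Submodule ℂ V)
    (hX : ∀ w ∈ pointwiseStabilizer W X, w • v = v) (w : W) :
    (indCoPt W X ≫ (indCo W X).ρ w).left ≫ indCoToSpace v X hX =
      Spec.map (CommRingCat.ofHom (evalAt (w • v) : Coord V →+* ℂ)) := by
  rw [Over.comp_left, Category.assoc, ρ_comp_indCoToSpace, ← Category.assoc,
    indCoPt_comp_indCoToSpace]
  refine (Spec.map_comp _ _).symm.trans (congrArg Spec.map (CommRingCat.hom_ext (RingHom.ext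
    fun a => ?_)))
  refine (evalAt_subgroup_smul w⁻¹ v a).trans ?_
  rw [inv_inv]
  rfl

theorem evalAt_injective : Function.Injective (evalAt : V → Coord V →ₐ[ℂ] ℂ) := by
  intro v w h
  rw [← sub_eq_zero, ← Module.forall_dual_apply_eq_zero_iff ℂ]
  intro ξ
  rw [map_sub, ← evalAt_ι, ← evalAt_ι, h, sub_self]

/-- The subgroup `W_X` is the stabilizer of the distinguished point. -/
theorem indCoPt_comp_ρ_eq_iff [FiniteDimensional ℂ V] [Finite W] {X : Submodule ℂ V} {w : W} :
    indCoPt W X ≫ (indCo W X).ρ w = indCoPt W X ↔ w ∈ pointwiseStabilizer W X := by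
  obtain ⟨v, -, hv⟩ := exists_stabilizer_eq_pointwiseStabilizer (W := W) X
  rw [hv]
  have h1 := indCoPt_comp_ρ_comp_indCoToSpace v X (fun w => (hv w).1) w
  have h2 := indCoPt_comp_indCoToSpace v X (fun w => (hv w).1)
  constructor
  · intro h
    rw [h, h2] at h1
    have h3 := CommRingCat.hom_ext_iff.1 (Spec.map_injective h1)
    exact (evalAt_injective (AlgHom.ext fun a => RingHom.congr_fun h3 a)).symm
  · intro h
    refine indCoPt_comp_eq hv ?_
    rw [h1, h2, h]

/-- The sections of an induced fibre are the translates of the distinguished point. -/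
theorem exists_eq_indCoPt_comp_ρ [FiniteDimensional ℂ V] [Finite W] {X : Submodule ℂ V}
    (σ : Over.mk (𝟙 (Spec (.of ℂ))) ⟶ (indCo W X).V) :
    ∃ w : W, σ = indCoPt W X ≫ (indCo W X).ρ w := by
  obtain ⟨v, -, hv⟩ := exists_stabilizer_eq_pointwiseStabilizer (W := W) X
  obtain ⟨j, hj⟩ := exists_iso_indCo hv
  obtain ⟨x, hx, hσ⟩ := exists_point_of_section (χ := evalInvariants W v) (σ ≫ j.inv.hom)
  obtain ⟨w, rfl⟩ := exists_smul_eq_of_evalAt_eq (W := W) (x := x) (v := v)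
    fun b => (DFunLike.congr_fun hx b).symm
  refine ⟨w, indCoPt_comp_eq hv ?_⟩
  rw [indCoPt_comp_ρ_comp_indCoToSpace, ← hσ]
  refine Eq.trans ?_ (congrArg ((σ ≫ j.inv.hom).left ≫ ·) hj)
  have h : j.inv.hom.left ≫ j.hom.hom.left = 𝟙 _ :=
    congrArg CommaMorphism.left (Action.inv_hom_hom j)
  rw [Over.comp_left, Category.assoc]
  refine congrArg (σ.left ≫ ·) ?_
  rw [← Category.assoc, h, Category.id_comp]

theorem comp_ρ_comp_hom {S : Scheme.{0}} {G : Type} [Group G] {C D : Action (Over S) G}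
    (e : C ≅ D) (σ : Over.mk (𝟙 S) ⟶ C.V) (g : G) :
    (σ ≫ C.ρ g) ≫ e.hom.hom = (σ ≫ e.hom.hom) ≫ D.ρ g := by
  rw [Category.assoc, Category.assoc, e.hom.comm]

theorem comp_ρ_eq_iff_of_iso {S : Scheme.{0}} {G : Type} [Group G] {C D : Action (Over S) G}
    (e : C ≅ D) (σ : Over.mk (𝟙 S) ⟶ C.V) (g : G) :
    (σ ≫ e.hom.hom) ≫ D.ρ g = σ ≫ e.hom.hom ↔ σ ≫ C.ρ g = σ := by
  rw [← comp_ρ_comp_hom, cancel_mono]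

/-- A pointed equivariant isomorphism preserves the stabilizer of the point, which is `W_X` and
determines `X`. -/
theorem eq_of_pointed_iso [FiniteDimensional ℂ V] [Finite W] {X Y : intersections W}
    (e : indCo W X.1 ≅ indCo W Y.1) (he : indCoPt W X.1 ≫ e.hom.hom = indCoPt W Y.1) : X = Y := by
  refine intersections_ext (Subgroup.ext fun w => ?_)
  rw [← indCoPt_comp_ρ_eq_iff, ← indCoPt_comp_ρ_eq_iff, ← he, comp_ρ_eq_iff_of_iso]

/-- The distinguished point goes to the `w`-translate of the other one. Comparing stabilizers gives
`W_X = w W_Y w⁻¹`, the group of `w • Y`. -/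
theorem exists_smul_eq_of_iso [FiniteDimensional ℂ V] [Finite W] {X Y : intersections W}
    (e : indCo W X.1 ≅ indCo W Y.1) : ∃ w : W, X = w • Y := by
  obtain ⟨w, hw⟩ := exists_eq_indCoPt_comp_ρ (indCoPt W X.1 ≫ e.hom.hom)
  refine ⟨w, intersections_ext (Subgroup.ext fun u => ?_)⟩
  rw [mem_pointwiseStabilizer_smul, ← indCoPt_comp_ρ_eq_iff, ← indCoPt_comp_ρ_eq_iff,
    ← comp_ρ_eq_iff_of_iso e, hw]
  -- Multiplication of endomorphisms is composition in the reverse order of `≫`.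
  have hmul : ∀ a b : W, (indCo W Y.1).ρ (a * b) = (indCo W Y.1).ρ b ≫ (indCo W Y.1).ρ a :=
    fun a b => map_mul (indCo W Y.1).ρ a b
  have hiso : (indCo W Y.1).ρ w ≫ (indCo W Y.1).ρ w⁻¹ = 𝟙 _ := by
    rw [← hmul, inv_mul_cancel]
    exact map_one (indCo W Y.1).ρ
  have hiso' : (indCo W Y.1).ρ w⁻¹ ≫ (indCo W Y.1).ρ w = 𝟙 _ := by
    rw [← hmul, mul_inv_cancel]
    exact map_one (indCo W Y.1).ρ
  rw [hmul, hmul]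
  constructor
  · intro h
    have := congrArg (· ≫ (indCo W Y.1).ρ w⁻¹) h
    simpa only [Category.assoc, hiso, Category.comp_id] using this
  · intro h
    have := congrArg (· ≫ (indCo W Y.1).ρ w) h
    simpa only [Category.assoc, hiso', Category.comp_id] using this

/-- If `v` is generic in `X`, then `w • v` has stabilizer `W_{wX}` and the same image in `V/W`, so
both are the same fibre. -/
theorem nonempty_iso_smul [FiniteDimensional ℂ V] [Finite W] (X : intersections W) (w : W) :
    Nonempty (indCo W (w • X).1 ≅ indCo W X.1) := by
  obtain ⟨v, -, hv⟩ := exists_stabilizer_eq_pointwiseStabilizer (W := W) X.1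
  have hwv : ∀ u : W, u ∈ pointwiseStabilizer W (w • X).1 ↔ u • w • v = w • v := by
    intro u
    rw [mem_pointwiseStabilizer_smul, hv, mul_smul, mul_smul, inv_smul_eq_iff]
  obtain ⟨i, -⟩ := exists_iso_indCo hwv
  obtain ⟨j, -⟩ := exists_iso_indCo hv
  rw [quotientPoint_smul] at i
  exact ⟨i.symm ≪≫ j⟩

end Classification

end Cameral

end

/-! ### The two bijections -/

theorem mainTheorem7 (V : Type) [AddCommGroup V] [Module ℂ V] [FiniteDimensional ℂ V]
    (W : Subgroup (V ≃ₗ[ℂ] V)) (hW : Cameral.IsReflectionGroup W) :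
    ∃ (hind : ∀ X : Cameral.intersections W,
        Cameral.IsCameralCover W (𝟙 (Spec (.of ℂ))) (Cameral.indCo W X.1))
      (Φ : Cameral.intersections W ≃
        Cameral.PointedCameralCoverClass W (𝟙 (Spec (.of ℂ))))
      (Ψ : MulAction.orbitRel.Quotient W (Cameral.intersections W) ≃
        Cameral.CameralCoverClass W (𝟙 (Spec (.of ℂ)))),
      (∀ X : Cameral.intersections W,
        Φ X = Quotient.mk _ ⟨Cameral.indCo W X.1, hind X, Cameral.indCoPt W X.1⟩) ∧
      (∀ X : Cameral.intersections W,
        Ψ (Quotient.mk _ X) = Quotient.mk _ ⟨Cameral.indCo W X.1, hind X⟩) ∧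
      (∀ C : Cameral.PointedCameralCover W (𝟙 (Spec (.of ℂ))), ∃ X : Cameral.intersections W,
        ∃ e : C.cover ≅ Cameral.indCo W X.1, C.pt ≫ e.hom.hom = Cameral.indCoPt W X.1) ∧
      (∀ C : Cameral.CameralCover W (𝟙 (Spec (.of ℂ))), ∃ X : Cameral.intersections W,
        Nonempty (C.obj ≅ Cameral.indCo W X.1)) := by
  have := hW.finite
  have hind : ∀ X : Cameral.intersections W,
      Cameral.IsCameralCover W (𝟙 (Spec (.of ℂ))) (Cameral.indCo W X.1) :=
    fun X => Cameral.isCameralCover_indCo X.1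
  have hpt (C : Cameral.PointedCameralCover W (𝟙 (Spec (.of ℂ)))) :
      ∃ X : Cameral.intersections W, ∃ e : C.cover ≅ Cameral.indCo W X.1,
        C.pt ≫ e.hom.hom = Cameral.indCoPt W X.1 :=
    Cameral.exists_iso_indCo_of_section hW C.isCameralCover C.pt
  have hcov (C : Cameral.CameralCover W (𝟙 (Spec (.of ℂ)))) :
      ∃ X : Cameral.intersections W, Nonempty (C.obj ≅ Cameral.indCo W X.1) :=
    Cameral.exists_iso_indCo_of_isCameralCover hW C.property
  let Φ : Cameral.intersections W → Cameral.PointedCameralCoverClass W (𝟙 (Spec (.of ℂ))) :=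
    fun X => Quotient.mk _ ⟨Cameral.indCo W X.1, hind X, Cameral.indCoPt W X.1⟩
  have hΦ : Function.Bijective Φ := by
    refine ⟨fun X Y h => ?_, fun c => ?_⟩
    · obtain ⟨e, he⟩ := Quotient.exact h
      exact Cameral.eq_of_pointed_iso e he
    · induction c using Quotient.inductionOn with
      | h C =>
        obtain ⟨X, e, he⟩ := hpt C
        exact ⟨X, Eq.symm (Quotient.sound ⟨e, he⟩)⟩
  let ψ (X : Cameral.intersections W) : Cameral.CameralCover W (𝟙 (Spec (.of ℂ))) :=
    ⟨Cameral.indCo W X.1, hind X⟩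
  let Ψ : MulAction.orbitRel.Quotient W (Cameral.intersections W) →
      Cameral.CameralCoverClass W (𝟙 (Spec (.of ℂ))) :=
    Quotient.lift (fun X => Quotient.mk _ (ψ X)) (by
      rintro X Y ⟨w, rfl⟩
      obtain ⟨e⟩ := Cameral.nonempty_iso_smul Y w
      exact Quotient.sound ⟨ObjectProperty.isoMk _ e⟩)
  have hΨ : Function.Bijective Ψ := by
    refine ⟨fun x y h => ?_, fun c => ?_⟩
    · induction x using Quotient.inductionOn with
      | h X =>
      induction y using Quotient.inductionOn with
      | h Y =>
        obtain ⟨e⟩ := Quotient.exact h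
        obtain ⟨w, hw⟩ := Cameral.exists_smul_eq_of_iso ((ObjectProperty.ι _).mapIso e)
        exact Quotient.sound ⟨w, hw.symm⟩
    · induction c using Quotient.inductionOn with
      | h C =>
        obtain ⟨X, ⟨e⟩⟩ := hcov C
        exact ⟨Quotient.mk _ X, Eq.symm (Quotient.sound ⟨ObjectProperty.isoMk _ e⟩)⟩
  exact ⟨hind, Equiv.ofBijective Φ hΦ, Equiv.ofBijective Ψ hΨ, fun _ => rfl, fun _ => rfl,
    hpt, hcov⟩
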